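/- **Model.** A graph $G=(V,E)$ with $V=\{0,\dots,n-1\}$, $n\ge 1$, is processed by $n$ machines $0,\dots,n-1$. The edge set is split among the machines arbitrarily: each edge is stored on exactly one machine, and no machine stores more than $n$ edges. Each machine knows $n$ and its own number, and has private independent uniform random bits. In each round every machine receives the messages sent to it in the previous round, performs a local computation, and sends messages to other machines; the local computations are given by computable functions that are the same for all $n$ and all graphs. In the last round machine $0$ reports a set of vertices $S$. The space (load) of a machine is the number of bits of all the data it handles during the whole execution: its share of the input, its random bits, all messages it receives or sends (with addresses), and, on machine $0$, the reported set. **Definitions.** For $S\subseteq V$ let $\Gamma_G(S)$ be the set of vertices that have a neighbour in $S$. $S$ is a dominating set if $S\cup\Gamma_G(S)=V$, and a dominating set with $\lambda$ outliers if $|S\cup\Gamma_G(S)|\ge(1-\lambda)|V|$. $S$ is an $\alpha$-approximate solution to dominating set with $\lambda$ outliers if it is a dominating set with $\lambda$ outliers and $|S|$ is at most $\alpha$ times the size of a smallest dominating set of $G$. **Theorem.** There is an absolute constant $c$ such that for all real $\varepsilon\in(0,1]$ and $\lambda>0$ with $(1+\varepsilon)\log\frac1\lambda\ge 1$ (natural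 logarithm) there are a four-round distributed algorithm and a constant $C=C(\varepsilon,\lambda)$ with the following properties, for every $n\ge1$, every graph $G$ on $n$ vertices and every split of its edges as above: 1. with probability at least $1-\frac2n$, the reported set is a $(1+\varepsilon)\log\frac1\lambda$-approximate solution to dominating set with $\lambda$ outliers on $G$; 2. in every execution, each machine uses at most $C\,n\,(1+\log n)^c=\tilde O(n)$ bits of space. -/

import Mathlib

/-! ### Dominating sets with outliers -/

namespace DominatingSet

/-- `S ∪ Γ(S)`: the vertices that lie in `S` or have a neighbour in `S`. -/
def dominated {V : Type*} (G : SimpleGraph V) (S : Finset V) : Set V :=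
  {v | v ∈ S ∨ ∃ u ∈ S, G.Adj u v}

/-- `S` is a dominating set: `S ∪ Γ(S) = V`. -/
def IsDominating {V : Type*} (G : SimpleGraph V) (S : Finset V) : Prop :=
  dominated G S = Set.univ

/-- `S` is a dominating set with `lam` outliers: `|S ∪ Γ(S)| ≥ (1 - lam) |V|`. -/
def IsDominatingWithOutliers {V : Type*} (G : SimpleGraph V) (lam : ℝ) (S : Finset V) : Prop :=
  (1 - lam) * (Nat.card V : ℝ) ≤ ((dominated G S).ncard : ℝ)

/-- The size of a smallest dominating set. On a finite vertex set the infimum is over a nonempty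
set of natural numbers, because the set of all vertices is dominating. -/
noncomputable def dominationNumber {V : Type*} (G : SimpleGraph V) : ℕ :=
  sInf {k | ∃ D : Finset V, IsDominating G D ∧ D.card = k}

/-- `S` is an `α`-approximate solution to dominating set with `lam` outliers: it is a dominating set
with `lam` outliers, and it has at most `α` times as many vertices as a smallest dominating set
(of the whole graph). -/
def IsApproxSolution {V : Type*} (G : SimpleGraph V) (lam α : ℝ) (S : Finset V) : Prop :=
  IsDominatingWithOutliers G lam S ∧ (S.card : ℝ) ≤ α * (dominationNumber G : ℝ)

end DominatingSet

/-! ### Synchronous distributed (MapReduce) computation on a graph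

A graph on the vertices `0, …, n - 1` is processed by `n` machines `0, …, n - 1`; machine `0` is the
one that reports the solution. Messages are finite lists of natural numbers (words). -/

namespace MapReduce

/-- The input data: the edge set of `G` is split among the machines. Every edge is stored exactly
once, on an arbitrary machine, in an arbitrary orientation and position in the list of that machine,
and no machine stores more than `n` edges. -/
structure EdgeSplit {n : ℕ} (G : SimpleGraph (Fin n)) where
  /-- The list of the edges stored on each machine. -/
  part : Fin n → List (Fin n × Fin n)
  adj_of_mem : ∀ i, ∀ e ∈ part i, G.Adj e.1 e.2
  exactly_once : ∀ u v, G.Adj u v →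
    ∑ i, ((part i).count (u, v) + (part i).count (v, u)) = 1
  length_le : ∀ i, (part i).length ≤ n

/-- All that a machine knows at some moment: the number `n` of vertices, its own number, its share
of the edges, its random bits, and, for each of the past message exchanges, the list of the messages
it received, indexed by the sender (an empty list stands for no message). -/
abbrev View : Type :=
  ℕ × ℕ × List (ℕ × ℕ) × List Bool × List (List (List ℕ))

/-- A randomized distributed algorithm. The local computations are computable functions, the same
ones for all graphs and all `n`. -/
structure Algorithm where
  /-- The number of random bits that each machine draws, as a function of `n`. -/
  coins : ℕ → ℕ
  /-- The message that a machine with the given view sends to the machine with the given number. -/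
  send : View → ℕ → List ℕ
  /-- The list of vertices that a machine with the given view would report as the solution. -/
  output : View → List ℕ
  coins_computable : Computable coins
  send_computable : Computable₂ send
  output_computable : Computable output

namespace Algorithm

variable (A : Algorithm) {n : ℕ} {G : SimpleGraph (Fin n)}

/-- The outcomes of the private random bits of all machines. -/
abbrev Coins (A : Algorithm) (n : ℕ) : Type := Fin n → Fin (A.coins n) → Bool

/-- The view of machine `i`, given the messages it has received so far. -/
def mkView (I : EdgeSplit G) (ω : A.Coins n) (i : Fin n) (received : List (List (List ℕ))) : View :=
  (n, (i : ℕ), (I.part i).map (fun e => ((e.1 : ℕ), (e.2 : ℕ))), List.ofFn (ω i), received)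

/-- What machine `i` has received in the first `r` message exchanges. -/
def received (I : EdgeSplit G) (ω : A.Coins n) : ℕ → Fin n → List (List (List ℕ))
  | 0, _ => []
  | r + 1, i => received I ω r i ++
      [List.ofFn fun j => A.send (A.mkView I ω j (received I ω r j)) (i : ℕ)]

/-- The view of machine `i` after `r` message exchanges, that is, when it does its computation in
round `r + 1`. -/
def view (I : EdgeSplit G) (ω : A.Coins n) (r : ℕ) (i : Fin n) : View :=
  A.mkView I ω i (A.received I ω r i)

/-- The message that machine `i` sends to machine `j` at the end of round `r + 1`. -/
def message (I : EdgeSplit G) (ω : A.Coins n) (r : ℕ) (i j : Fin n) : List ℕ :=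
  A.send (A.view I ω r i) (j : ℕ)

/-- What machine `0` reports in an execution with the given number of rounds. In each round every
machine receives the messages of the previous round, computes, and sends messages; in the last round
machine `0` reports instead, so there are `rounds - 1` message exchanges. -/
def report [NeZero n] (I : EdgeSplit G) (ω : A.Coins n) (rounds : ℕ) : List ℕ :=
  A.output (A.view I ω (rounds - 1) 0)

/-- The reported set of vertices. -/
def solution [NeZero n] (I : EdgeSplit G) (ω : A.Coins n) (rounds : ℕ) : Finset (Fin n) :=
  Finset.univ.filter fun v => (v : ℕ) ∈ A.report I ω rounds

/-- The number of bits of a list of words; each word has its binary digits and a separator. -/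
def wordBits (m : List ℕ) : ℕ :=
  (m.map fun w => Nat.size w + 1).sum

/-- The number of bits of a message between two of `n` machines. A message that is not empty
also carries an address. -/
def messageBits (n : ℕ) (m : List ℕ) : ℕ :=
  if m = [] then 0 else Nat.size n + wordBits m

/-- The load (space) of machine `i`: the number of bits of all the data it handles during the whole
execution, namely its share of the input, its random bits, all messages that it receives or sends,
and the reported list on machine `0`. -/
def load [NeZero n] (I : EdgeSplit G) (ω : A.Coins n) (rounds : ℕ) (i : Fin n) : ℕ :=
  ((I.part i).map fun e => wordBits [(e.1 : ℕ), (e.2 : ℕ)]).sum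
  + A.coins n
  + ∑ r ∈ Finset.range (rounds - 1), ∑ j, messageBits n (A.message I ω r j i)
  + ∑ r ∈ Finset.range (rounds - 1), ∑ j, messageBits n (A.message I ω r i j)
  + (if i = 0 then wordBits (A.report I ω rounds) else 0)

/-- The probability of an event when all random bits are independent and uniform. -/
noncomputable def prob (n : ℕ) (P : A.Coins n → Prop) : ℝ :=
  ({ω | P ω}.ncard : ℝ) / (Nat.card (A.Coins n) : ℝ)

end Algorithm

end MapReduce

/-!
Local computations are only required to be computable, so machine `0` may search exhaustively, and
since the approximation factor is at least `1` it suffices to report a set that is at most as large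
as a smallest dominating set and that leaves at most a fraction `lam` of the vertices undominated.
The question is how to recognize such a set from `Õ(n)` bits of information about the graph.

Let `ℓ = Nat.size n`, let `1 / q ≤ lam`, and let `K`, `D`, `T` be constants depending on `q` only.
Machine `0` draws `n` blocks of `K * ℓ` random vertices each. In the three message exchanges every
vertex `v` learns its neighbours, machine `0` requests from every sampled vertex of the `k`-th block
about `D * n / k` elements of its closed neighbourhood, and these truncated neighbourhoods are
returned. As `∑ 1 / k = O(log n)`, they have total length `O(n log² n)` whatever the random bits are
(`sum_request_le`, `load_le`). Machine `0` reports the shortest nonempty list `S` that misses at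
most a fraction `1 / T` of the truncated neighbourhoods in the first `S.length` blocks.

* A list of length `k` that leaves more than a fraction `1 / q` of the vertices undominated misses
  the neighbourhoods of all samples among these vertices, so it is accepted with probability at most
  `n ^ (- 3 * k)` (`prob_samplesIn_le`). A union bound over all lists shows that with probability at
  least `1 - 1 / n` no such list is accepted (`sum_candidates_le`).
* Let `k` be the size of a smallest dominating set. Truncation does no harm: a small fraction of the
  `k` dominators, namely those that are used least, can be exchanged for vertices that hit almost all
  neighbourhoods of size at least `D * n / k`. So some `k` vertices hit the truncated neighbourhoods
  of almost all vertices (`exists_list_hitting`), and this list is accepted with probability at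
  least `1 - 1 / n` (`prob_lt_samplesIn_le`). Hence the reported list has length at most `k`.

The requests depend on the samples, so the returned lists are not independent of them. The analysis
therefore compares the number of missed samples from below with the number of samples in a fixed set
of undominated vertices, and from above with the number of samples whose neighbourhoods, truncated
at the fixed length of the `k`-th block, are missed (`samplesIn_undominated_of_accepted`,
`accepted_of_samplesIn`).
-/

namespace DominatingSketch

open MapReduce DominatingSet

/-! ### The algorithm -/

/-- The number with the given binary digits, least significant digit first. -/
def bitsValue (l : List Bool) : ℕ :=
  l.foldr (fun b s => 2 * s + b.toNat) 0

/-- The number of samples in a block, where `K` is a constant of the algorithm. -/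
def blockLen (K n : ℕ) : ℕ := K * Nat.size n

/-- The `p`-th sample: the number formed by the `p`-th group of `Nat.size n` random bits, modulo
`n`. Its distribution on the vertices is uniform up to a factor of `2`. -/
def sample (n : ℕ) (coins : List Bool) (p : ℕ) : ℕ :=
  bitsValue ((coins.drop (p * Nat.size n)).take (Nat.size n)) % n

/-- The bound on the length of the list requested from the `p`-th sample. In the `k`-th block (with
`k` counted from `1`) it is about `D * n / k`. -/
def cap (K D n p : ℕ) : ℕ := D * n / (p / blockLen K n + 1) + 1

/-- The index of the first of the `n * blockLen K n` samples that equals `v`, or `n * blockLen K n` if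
there is none. -/
def firstSample (K n : ℕ) (coins : List Bool) (v : ℕ) : ℕ :=
  (List.range (n * blockLen K n)).findIdx fun p => decide (sample n coins p = v)

/-- The endpoints opposite to `j` of the edges at `j` in a list of edges. -/
def neighborsIn (l : List (ℕ × ℕ)) (j : ℕ) : List ℕ :=
  l.filterMap fun e => if e.1 = j then some e.2 else if e.2 = j then some e.1 else none

/-- All lists of length `k` with entries less than `n`. -/
def listsOfLength (n : ℕ) : ℕ → List (List ℕ)
  | 0 => [[]]
  | k + 1 => (listsOfLength n k).flatMap fun l => (List.range n).map fun u => u :: l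

/-- All lists with entries less than `n` and length between `1` and `n`, shorter ones first. -/
def candidates (n : ℕ) : List (List ℕ) :=
  (List.range n).flatMap fun k => listsOfLength n (k + 1)

/-- The samples in the first `S.length` blocks whose lists in the sketch `L` are missed by `S`. -/
def missedSamples (K n : ℕ) (coins : List Bool) (L : List (List ℕ)) (S : List ℕ) : List ℕ :=
  (List.range (S.length * blockLen K n)).filter fun p =>
    decide (¬ ∃ u ∈ S, u ∈ L.getD (sample n coins p) [])

/-- A list of vertices is accepted if it misses at most a `1 / T` fraction of the samples in its
blocks. -/
def Accepted (K T n : ℕ) (coins : List Bool) (L : List (List ℕ)) (S : List ℕ) : Prop :=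
  T * (missedSamples K n coins L S).length ≤ S.length * blockLen K n

instance (K T n : ℕ) (coins : List Bool) (L : List (List ℕ)) (S : List ℕ) :
    Decidable (Accepted K T n coins L S) := by
  unfold Accepted; infer_instance

/-- The first accepted candidate, or the empty list if there is none. -/
def firstAccepted (K T n : ℕ) (coins : List Bool) (L : List (List ℕ)) : List ℕ :=
  (candidates n).getD ((candidates n).findIdx fun S => decide (Accepted K T n coins L S)) []

/-- The messages of the algorithm. First, for every edge both endpoints are told about each other.
Secondly, machine `0` draws the samples and tells every machine `v` how many words to return.
Thirdly, every machine `v` returns that many elements of the closed neighbourhood of `v`. -/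
def sendFun (K D : ℕ) (V : View) (j : ℕ) : List ℕ :=
  if V.2.2.2.2.length = 0 then neighborsIn V.2.2.1 j
  else if V.2.2.2.2.length = 1 then
    if V.2.1 = 0 then [cap K D V.1 (firstSample K V.1 V.2.2.2.1 j)] else []
  else if j = 0 then
    (V.2.1 :: (V.2.2.2.2.getD 0 []).flatten).take (((V.2.2.2.2.getD 1 []).getD 0 []).getD 0 0)
  else []

/-- Machine `0` reports the first candidate that is accepted on the sketch it has received. -/
def outputFun (K T : ℕ) (V : View) : List ℕ :=
  firstAccepted K T V.1 V.2.2.2.1 (V.2.2.2.2.getD 2 [])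

/-! ### Computability of the local computations -/

theorem primrec_pow : Primrec₂ ((· ^ ·) : ℕ → ℕ → ℕ) :=
  Primrec₂.unpaired'.1 Nat.Primrec.pow

theorem primrec_size : Primrec Nat.size := by
  have h : Primrec fun n : ℕ => (List.range (n + 1)).findIdx fun b => decide (n < 2 ^ b) :=
    Primrec.list_findIdx (Primrec.list_range.comp Primrec.succ)
      (PrimrecRel.comp Primrec.nat_lt Primrec.fst
        (primrec_pow.comp (Primrec.const 2) Primrec.snd)).decide
  refine h.of_eq fun n => ?_
  have hs : Nat.size n < (List.range (n + 1)).length := by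
    simpa [Nat.lt_succ_iff] using Nat.size_le.2 Nat.lt_two_pow_self
  refine (List.findIdx_eq hs).2 ⟨by simpa using Nat.lt_size_self n, fun j hj => ?_⟩
  simpa using Nat.lt_size.1 hj

theorem primrec_blockLen (K : ℕ) : Primrec (blockLen K) :=
  Primrec.nat_mul.comp (Primrec.const K) primrec_size

theorem primrec_bitsValue : Primrec bitsValue := by
  have h : Primrec₂ fun (_ : List Bool) (x : Bool × ℕ) => 2 * x.2 + x.1.toNat :=
    Primrec.nat_add.comp
      (Primrec.nat_mul.comp (Primrec.const 2) (Primrec.snd.comp Primrec.snd))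
      ((Primrec.dom_bool Bool.toNat).comp (Primrec.fst.comp Primrec.snd))
  exact Primrec.list_foldr Primrec.id (Primrec.const 0) h

section Primrec

variable {α : Type*} [Primcodable α]

theorem primrec_sample {f : α → ℕ} {c : α → List Bool} {g : α → ℕ} (hf : Primrec f)
    (hc : Primrec c) (hg : Primrec g) : Primrec fun a => sample (f a) (c a) (g a) :=
  Primrec.nat_mod.comp
    (primrec_bitsValue.comp (Primrec.list_take.comp (primrec_size.comp hf)
      (Primrec.list_drop.comp (Primrec.nat_mul.comp hg (primrec_size.comp hf)) hc))) hf

theorem primrec_cap (K D : ℕ) : Primrec₂ (cap K D) :=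
  Primrec.succ.comp (Primrec.nat_div.comp
    (Primrec.nat_mul.comp (Primrec.const D) Primrec.fst)
    (Primrec.succ.comp (Primrec.nat_div.comp Primrec.snd ((primrec_blockLen K).comp Primrec.fst))))

theorem primrec_firstSample (K : ℕ) {f : α → ℕ} {c : α → List Bool} {g : α → ℕ} (hf : Primrec f)
    (hc : Primrec c) (hg : Primrec g) : Primrec fun a => firstSample K (f a) (c a) (g a) :=
  Primrec.list_findIdx
    (Primrec.list_range.comp (Primrec.nat_mul.comp hf ((primrec_blockLen K).comp hf)))
    (PrimrecRel.comp Primrec.eq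
      (primrec_sample (hf.comp Primrec.fst) (hc.comp Primrec.fst) Primrec.snd)
      (hg.comp Primrec.fst)).decide

theorem primrec_neighborsIn : Primrec₂ neighborsIn := by
  refine Primrec.listFilterMap Primrec.fst ?_
  have h1 : Primrec fun x : (List (ℕ × ℕ) × ℕ) × (ℕ × ℕ) => x.2.1 :=
    Primrec.fst.comp Primrec.snd
  have h2 : Primrec fun x : (List (ℕ × ℕ) × ℕ) × (ℕ × ℕ) => x.2.2 :=
    Primrec.snd.comp Primrec.snd
  have hj : Primrec fun x : (List (ℕ × ℕ) × ℕ) × (ℕ × ℕ) => x.1.2 :=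
    Primrec.snd.comp Primrec.fst
  exact Primrec.ite (Primrec.eq.comp h1 hj) (Primrec.option_some.comp h2)
    (Primrec.ite (Primrec.eq.comp h2 hj) (Primrec.option_some.comp h1) (Primrec.const none))

end Primrec

theorem primrec_listsOfLength : Primrec₂ listsOfLength := by
  have h : Primrec₂ fun n k : ℕ => (Nat.rec [[]] (fun _ ls => ls.flatMap fun l =>
      (List.range n).map fun u => u :: l) k : List (List ℕ)) := by
    refine Primrec.nat_rec (g := fun n (x : ℕ × List (List ℕ)) => x.2.flatMap fun l =>
      (List.range n).map fun u => u :: l) (Primrec.const [[]]) ?_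
    refine Primrec.list_flatMap (Primrec.snd.comp Primrec.snd) ?_
    refine Primrec.list_map (Primrec.list_range.comp (Primrec.fst.comp Primrec.fst)) ?_
    exact Primrec.list_cons.comp Primrec.snd (Primrec.snd.comp Primrec.fst)
  refine h.of_eq fun n k => ?_
  induction k with
  | zero => rfl
  | succ k ih => simp only [listsOfLength, ← ih]

theorem primrec_candidates : Primrec candidates :=
  Primrec.list_flatMap Primrec.list_range
    (primrec_listsOfLength.comp Primrec.fst (Primrec.succ.comp Primrec.snd))

theorem primrecRel_mem {β : Type*} [Primcodable β] : PrimrecRel fun (b : β) (L : List β) => b ∈ L :=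
  ((PrimrecRel.exists_mem_list (Primrec.eq (α := β))).comp Primrec.snd Primrec.fst).of_eq
    fun p => by simp

theorem primrecRel_disjoint : PrimrecRel fun (S L : List ℕ) => ∃ u ∈ S, u ∈ L :=
  PrimrecRel.exists_mem_list primrecRel_mem

/-- The data on which machine `0` runs its final test: `n`, its random bits and the sketch. -/
abbrev Sketch : Type := ℕ × List Bool × List (List ℕ)

theorem primrec_missedSamples (K : ℕ) : Primrec fun x : Sketch × List ℕ =>
    missedSamples K x.1.1 x.1.2.1 x.1.2.2 x.2 := by
  have hR : PrimrecRel fun (p : ℕ) (x : Sketch × List ℕ) =>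
      ¬ ∃ u ∈ x.2, u ∈ x.1.2.2.getD (sample x.1.1 x.1.2.1 p) [] := by
    refine PrimrecPred.not (primrecRel_disjoint.comp (Primrec.snd.comp Primrec.snd) ?_)
    have hx : Primrec fun y : ℕ × (Sketch × List ℕ) => y.2.1 := Primrec.fst.comp Primrec.snd
    exact (Primrec.list_getD []).comp (Primrec.snd.comp (Primrec.snd.comp hx))
      (primrec_sample (Primrec.fst.comp hx) (Primrec.fst.comp (Primrec.snd.comp hx)) Primrec.fst)
  classical
  refine ((PrimrecRel.listFilter hR).comp (Primrec.list_range.comp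
    (Primrec.nat_mul.comp (Primrec.list_length.comp Primrec.snd)
      ((primrec_blockLen K).comp (Primrec.fst.comp Primrec.fst)))) Primrec.id).of_eq fun x => ?_
  simp only [missedSamples, id]

theorem primrec_firstAccepted (K T : ℕ) : Primrec fun x : Sketch =>
    firstAccepted K T x.1 x.2.1 x.2.2 := by
  have hc : Primrec fun x : Sketch => candidates x.1 := primrec_candidates.comp Primrec.fst
  refine (Primrec.list_getD []).comp hc (Primrec.list_findIdx hc ?_)
  exact (PrimrecRel.comp Primrec.nat_le
    (Primrec.nat_mul.comp (Primrec.const T)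
      (Primrec.list_length.comp (primrec_missedSamples K)))
    (Primrec.nat_mul.comp (Primrec.list_length.comp Primrec.snd)
      ((primrec_blockLen K).comp (Primrec.fst.comp Primrec.fst)))).decide

theorem primrec_outputFun (K T : ℕ) : Primrec (outputFun K T) := by
  have h2 : Primrec fun V : View => V.2.2.2 := Primrec.snd.comp (Primrec.snd.comp Primrec.snd)
  exact (primrec_firstAccepted K T).comp (Primrec.fst.pair ((Primrec.fst.comp h2).pair
    ((Primrec.list_getD []).comp (Primrec.snd.comp h2) (Primrec.const 2))))

theorem primrec_sendFun (K D : ℕ) : Primrec₂ (sendFun K D) := by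
  have h1 : Primrec fun x : View × ℕ => x.1.2 := Primrec.snd.comp Primrec.fst
  have h2 : Primrec fun x : View × ℕ => x.1.2.2 := Primrec.snd.comp h1
  have h3 : Primrec fun x : View × ℕ => x.1.2.2.2 := Primrec.snd.comp h2
  have hr : Primrec fun x : View × ℕ => x.1.2.2.2.2 := Primrec.snd.comp h3
  have hn : Primrec fun x : View × ℕ => x.1.1 := Primrec.fst.comp Primrec.fst
  have hi : Primrec fun x : View × ℕ => x.1.2.1 := Primrec.fst.comp h1
  have hlen := Primrec.list_length.comp hr
  refine Primrec.ite (Primrec.eq.comp hlen (Primrec.const 0))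
    (primrec_neighborsIn.comp (Primrec.fst.comp h2) Primrec.snd)
    (Primrec.ite (Primrec.eq.comp hlen (Primrec.const 1))
      (Primrec.ite (Primrec.eq.comp hi (Primrec.const 0)) ?_ (Primrec.const []))
      (Primrec.ite (Primrec.eq.comp Primrec.snd (Primrec.const 0)) ?_ (Primrec.const [])))
  · exact Primrec.list_cons.comp ((primrec_cap K D).comp hn
      (primrec_firstSample K hn (Primrec.fst.comp h3) Primrec.snd)) (Primrec.const [])
  · exact Primrec.list_take.comp
      ((Primrec.list_getD 0).comp ((Primrec.list_getD []).comp
        ((Primrec.list_getD []).comp hr (Primrec.const 1)) (Primrec.const 0)) (Primrec.const 0))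
      (Primrec.list_cons.comp hi (Primrec.list_flatten.comp
        ((Primrec.list_getD []).comp hr (Primrec.const 0))))

/-- The four-round algorithm; `K`, `D` and `T` are constants that depend on the fraction of
outliers. -/
def algorithm (K D T : ℕ) : Algorithm where
  coins n := n * blockLen K n * Nat.size n
  send := sendFun K D
  output := outputFun K T
  coins_computable := (Primrec.nat_mul.comp (Primrec.nat_mul.comp Primrec.id (primrec_blockLen K))
    primrec_size).to_comp
  send_computable := (primrec_sendFun K D).to_comp
  output_computable := (primrec_outputFun K T).to_comp

/-! ### A small set that hits almost all truncated neighbourhoods -/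

/-- Among the elements of `s`, some `r` have together at most their proportional share of the total
weight. -/
theorem exists_subset_sum_le {ι : Type*} [DecidableEq ι] (f : ι → ℕ) (s : Finset ι) :
    ∀ r ≤ s.card, ∃ t ⊆ s, t.card = r ∧ s.card * ∑ i ∈ t, f i ≤ r * ∑ i ∈ s, f i := by
  intro r
  induction r with
  | zero => exact fun _ => ⟨∅, by simp⟩
  | succ r ih =>
    intro hr
    obtain ⟨t, hts, htr, hle⟩ := ih (by omega)
    have hcard : (s \ t).card = s.card - r := by rw [Finset.card_sdiff_of_subset hts, htr]
    have hne : (s \ t).Nonempty := by rw [← Finset.card_pos]; omega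
    obtain ⟨x, hx, hmin⟩ := Finset.exists_min_image (s \ t) f hne
    have hxs := (Finset.mem_sdiff.1 hx).1
    have hxt := (Finset.mem_sdiff.1 hx).2
    refine ⟨insert x t, Finset.insert_subset hxs hts, by rw [Finset.card_insert_of_notMem hxt, htr],
      ?_⟩
    rw [Finset.sum_insert hxt]
    have h1 : (s.card - r) * f x ≤ ∑ i ∈ s \ t, f i := by
      rw [← hcard, ← smul_eq_mul]
      exact Finset.card_nsmul_le_sum _ _ _ hmin
    have h2 := Finset.sum_sdiff (f := f) hts
    obtain ⟨d, hd⟩ : ∃ d, s.card = r + 1 + d := ⟨s.card - (r + 1), by omega⟩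
    have h3 : s.card - r = d + 1 := by omega
    rw [h3] at h1
    rw [hd] at hle ⊢
    rw [← h2] at hle ⊢
    refine Nat.le_of_mul_le_mul_left (c := d + 1) ?_ (Nat.succ_pos d)
    generalize ∑ i ∈ t, f i = A at *
    generalize ∑ i ∈ s \ t, f i = B at *
    nlinarith [Nat.mul_le_mul_left (r + 1 + d) h1, Nat.mul_le_mul_left d hle]

/-- Greedy choice: if every set `N v` with `v ∈ H` contains at least a `D / k` fraction of all
elements, then some `r` elements hit all but an `exp (- r * D / k)` fraction of these sets. -/
theorem exists_list_hitting_large {n : ℕ} (hn : 0 < n) (N : Fin n → Finset (Fin n)) {k D : ℕ}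
    (hk : 0 < k) (H : Finset (Fin n)) (hH : ∀ v ∈ H, D * n ≤ k * (N v).card) (r : ℕ) :
    ∃ R : List (Fin n), R.length = r ∧
      ((H.filter fun v => ∀ u ∈ R, u ∉ N v).card : ℝ) ≤ n * Real.exp (-(r * (D / k))) := by
  induction r with
  | zero =>
    refine ⟨[], rfl, ?_⟩
    simpa using H.card_le_univ
  | succ r ih =>
    obtain ⟨R, hR, hle⟩ := ih
    set U := H.filter fun v => ∀ u ∈ R, u ∉ N v with hU
    have hUH : ∀ v ∈ U, D * n ≤ k * (N v).card := fun v hv => hH v (Finset.mem_filter.1 hv).1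
    have hdc : ∑ u, (U.filter fun v => u ∈ N v).card = ∑ v ∈ U, (N v).card := by
      simp only [Finset.card_filter]
      rw [Finset.sum_comm]
      refine Finset.sum_congr rfl fun v _ => ?_
      simp
    have hsum : U.card * (D * n) ≤ ∑ u, k * (U.filter fun v => u ∈ N v).card := by
      rw [← Finset.mul_sum, hdc, Finset.mul_sum, ← smul_eq_mul]
      exact Finset.card_nsmul_le_sum _ _ _ hUH
    obtain ⟨u, hu⟩ : ∃ u, U.card * D ≤ k * (U.filter fun v => u ∈ N v).card := by
      have : Nonempty (Fin n) := ⟨⟨0, hn⟩⟩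
      have : ∑ _u : Fin n, U.card * D ≤ ∑ u, k * (U.filter fun v => u ∈ N v).card := by
        simpa [mul_comm, mul_left_comm, mul_assoc] using hsum
      obtain ⟨u, -, hu⟩ := Finset.exists_le_of_sum_le Finset.univ_nonempty this
      exact ⟨u, hu⟩
    refine ⟨u :: R, by simp [hR], ?_⟩
    have hsplit : (H.filter fun v => ∀ w ∈ u :: R, w ∉ N v) = U.filter fun v => u ∉ N v := by
      ext v
      simp only [hU, List.mem_cons, forall_eq_or_imp, Finset.mem_filter]
      tauto
    rw [hsplit]
    have hadd : (U.filter fun v => u ∈ N v).card + (U.filter fun v => u ∉ N v).card = U.card :=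
      Finset.card_filter_add_card_filter_not _
    have hk' : (0 : ℝ) < k := by exact_mod_cast hk
    have hu' : (U.card : ℝ) * (D / k) ≤ (U.filter fun v => u ∈ N v).card := by
      rw [← mul_div_assoc, div_le_iff₀ hk', mul_comm _ (k : ℝ)]
      exact_mod_cast hu
    have hadd' : ((U.filter fun v => u ∈ N v).card : ℝ) + (U.filter fun v => u ∉ N v).card
        = U.card := by exact_mod_cast hadd
    calc ((U.filter fun v => u ∉ N v).card : ℝ) ≤ U.card * (-(D / k : ℝ) + 1) := by linarith
      _ ≤ U.card * Real.exp (-(D / k)) := by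
        gcongr
        exact Real.add_one_le_exp _
      _ ≤ (n * Real.exp (-(r * (D / k)))) * Real.exp (-(D / k)) := by gcongr
      _ = n * Real.exp (-((r + 1 : ℕ) * (D / k))) := by
        rw [mul_assoc, ← Real.exp_add]
        push_cast
        ring_nf

/-- Let every `N v` either contain the closed neighbourhood of `v` or be of size at least
`8 * Q ^ 2 * n / k`. If `G` has a dominating set of size `k`, then some `k` vertices hit all but a
`1 / Q` fraction of the sets `N v`: a few of the dominators that are used least are exchanged for
vertices that hit almost all of the large sets. -/
theorem exists_list_hitting {n : ℕ} (hn : 0 < n) (G : SimpleGraph (Fin n))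
    (N : Fin n → Finset (Fin n)) {Q : ℕ} (hQ : 0 < Q) (S : Finset (Fin n)) (hS : IsDominating G S)
    (hN : ∀ v, (∀ u, u = v ∨ G.Adj u v → u ∈ N v) ∨
      8 * Q ^ 2 * n ≤ S.card * (N v).card) :
    ∃ L : List (Fin n), L.length = S.card ∧
      Q * (Finset.univ.filter fun v => ∀ u ∈ L, u ∉ N v).card ≤ n := by
  have hdom : ∀ v, ∃ u ∈ S, u = v ∨ G.Adj u v := by
    intro v
    have hv : v ∈ dominated G S := by rw [hS]; trivial
    rcases hv with hv | ⟨u, hu, huv⟩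
    exacts [⟨v, hv, Or.inl rfl⟩, ⟨u, hu, Or.inr huv⟩]
  choose dom hdomS hdom using hdom
  have hk : 0 < S.card := Finset.card_pos.2 ⟨_, hdomS ⟨0, hn⟩⟩
  have hcard : ∀ v, (N v).card ≤ n := fun v => by simpa using (N v).card_le_univ
  rcases lt_or_ge S.card (2 * Q) with hlt | hge
  · -- All the sets `N v` are complete, because none can have more than `n` elements.
    refine ⟨S.toList, by simp, ?_⟩
    have hempty : (Finset.univ.filter fun v => ∀ u ∈ S.toList, u ∉ N v) = ∅ := by
      rw [Finset.filter_eq_empty_iff]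
      intro v _ hv
      refine hv (dom v) (by simpa using hdomS v) ?_
      rcases hN v with h | h
      · exact h _ (hdom v)
      · exfalso
        have h1 : S.card * (N v).card ≤ S.card * n := Nat.mul_le_mul_left _ (hcard v)
        have h2 : S.card * n < 2 * Q * n := Nat.mul_lt_mul_of_pos_right hlt hn
        have h3 : 2 * Q * n ≤ 8 * Q ^ 2 * n := Nat.mul_le_mul_right _ (by nlinarith)
        omega
    rw [hempty]
    simp
  · set k := S.card with hkdef
    set r := k / (2 * Q) with hr
    have hrk : r * (2 * Q) ≤ k := Nat.div_mul_le_self _ _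
    have hr1 : 1 ≤ r := (Nat.one_le_div_iff (by omega)).2 hge
    have hkr : k ≤ r * (4 * Q) := by
      have h1 : k < 2 * Q * (r + 1) := Nat.lt_mul_div_succ k (by omega)
      nlinarith
    obtain ⟨t, htS, htr, htle⟩ := exists_subset_sum_le
      (fun u => (Finset.univ.filter fun v => dom v = u).card) S r (by nlinarith)
    have htotal : ∑ u ∈ S, (Finset.univ.filter fun v => dom v = u).card = n := by
      rw [← Finset.card_eq_sum_card_fiberwise (f := dom) (s := Finset.univ) (t := S)
        (fun v _ => hdomS v)]
      simp
    have htfib : ∑ u ∈ t, (Finset.univ.filter fun v => dom v = u).card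
        = (Finset.univ.filter fun v => dom v ∈ t).card := by
      rw [Finset.card_eq_sum_card_fiberwise (f := dom) (t := t)]
      · refine Finset.sum_congr rfl fun u hu => ?_
        congr 1
        ext v
        simp only [Finset.mem_filter, Finset.mem_univ, true_and]
        exact ⟨fun h => ⟨h ▸ hu, h⟩, fun h => h.2⟩
      · intro v hv
        simpa using hv
    rw [htotal, htfib] at htle
    set H := Finset.univ.filter fun v => 8 * Q ^ 2 * n ≤ k * (N v).card with hH
    obtain ⟨R, hRr, hRle⟩ := exists_list_hitting_large hn N hk H
      (fun v hv => (Finset.mem_filter.1 hv).2) r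
    refine ⟨(S \ t).toList ++ R, ?_, ?_⟩
    · rw [List.length_append, Finset.length_toList, Finset.card_sdiff_of_subset htS, hRr, htr]
      have : r ≤ k := by nlinarith
      omega
    have hsub : (Finset.univ.filter fun v => ∀ u ∈ (S \ t).toList ++ R, u ∉ N v) ⊆
        (Finset.univ.filter fun v => dom v ∈ t) ∪ H.filter fun v => ∀ u ∈ R, u ∉ N v := by
      intro v hv
      simp only [Finset.mem_filter, Finset.mem_univ, true_and, List.mem_append,
        Finset.mem_toList, Finset.mem_sdiff] at hv
      simp only [Finset.mem_union, Finset.mem_filter, Finset.mem_univ, true_and, hH]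
      rcases hN v with h | h
      · left
        by_contra hvt
        exact hv (dom v) (Or.inl ⟨hdomS v, hvt⟩) (h _ (hdom v))
      · exact Or.inr ⟨h, fun u hu => hv u (Or.inr hu)⟩
    have hle := (Finset.card_le_card hsub).trans (Finset.card_union_le _ _)
    have hA : 2 * Q * (Finset.univ.filter fun v => dom v ∈ t).card ≤ n := by
      refine Nat.le_of_mul_le_mul_left (c := k) ?_ hk
      calc k * (2 * Q * (Finset.univ.filter fun v => dom v ∈ t).card)
          = 2 * Q * (k * (Finset.univ.filter fun v => dom v ∈ t).card) := by ring
        _ ≤ 2 * Q * (r * n) := Nat.mul_le_mul_left _ htle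
        _ = r * (2 * Q) * n := by ring
        _ ≤ k * n := Nat.mul_le_mul_right _ hrk
    have hB : 2 * (Q : ℝ) * (H.filter fun v => ∀ u ∈ R, u ∉ N v).card ≤ n := by
      have hQ' : (0 : ℝ) < Q := by exact_mod_cast hQ
      have hk' : (0 : ℝ) < k := by exact_mod_cast hk
      have hx : 2 * (Q : ℝ) ≤ r * ((8 * Q ^ 2 : ℕ) / k) := by
        rw [← mul_div_assoc, le_div_iff₀ hk']
        have : (k : ℝ) ≤ r * (4 * Q) := by exact_mod_cast hkr
        push_cast
        nlinarith
      have hexp : 2 * (Q : ℝ) * Real.exp (-(r * ((8 * Q ^ 2 : ℕ) / k))) ≤ 1 := by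
        rw [Real.exp_neg, ← div_eq_mul_inv, div_le_one (Real.exp_pos _)]
        exact (by linarith [Real.add_one_le_exp (2 * (Q : ℝ))] : 2 * (Q : ℝ) ≤ _).trans
          (Real.exp_le_exp.2 hx)
      calc 2 * (Q : ℝ) * (H.filter fun v => ∀ u ∈ R, u ∉ N v).card
          ≤ 2 * (Q : ℝ) * (n * Real.exp (-(r * ((8 * Q ^ 2 : ℕ) / k)))) := by gcongr
        _ = n * (2 * (Q : ℝ) * Real.exp (-(r * ((8 * Q ^ 2 : ℕ) / k)))) := by ring
        _ ≤ n * 1 := by gcongr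
        _ = n := mul_one _
    have hB' : 2 * Q * (H.filter fun v => ∀ u ∈ R, u ∉ N v).card ≤ n := by exact_mod_cast hB
    nlinarith

/-! ### Concentration of the number of samples in a set -/

/-- The number of the first `m` coordinates of `x` that lie in `U`. -/
def hits {W : Type*} [DecidableEq W] {M : ℕ} (m : ℕ) (U : Finset W) (x : Fin M → W) : ℕ :=
  (Finset.univ.filter fun p : Fin M => (p : ℕ) < m ∧ x p ∈ U).card

/-- Exponential Markov inequality for the number of hits, in both directions according to the sign
of `s`. -/
theorem card_le_mul_hits {W : Type*} [Fintype W] [DecidableEq W] [Nonempty W] {M m : ℕ}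
    (hm : m ≤ M) (U : Finset W) (s c : ℝ) :
    ((Finset.univ.filter fun x : Fin M → W => c ≤ s * hits m U x).card : ℝ) ≤
      (Fintype.card W : ℝ) ^ M *
        Real.exp (m * ((U.card / Fintype.card W : ℝ) * (Real.exp s - 1)) - c) := by
  set w : ℝ := ((Fintype.card W : ℕ) : ℝ) with hw
  have hwpos : 0 < w := by simp [hw, Fintype.card_pos]
  let f : Fin M → W → ℝ := fun p a => if (p : ℕ) < m ∧ a ∈ U then Real.exp s else 1
  have hf : ∀ x : Fin M → W, Real.exp (s * hits m U x) = ∏ p, f p (x p) := by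
    intro x
    rw [Finset.prod_ite, Finset.prod_const, Finset.prod_const_one, mul_one, mul_comm,
      Real.exp_nat_mul]
    rfl
  have hsum : ∑ x : Fin M → W, Real.exp (s * hits m U x) = ∏ p, ∑ a, f p a := by
    rw [Finset.prod_univ_sum, Fintype.piFinset_univ]
    exact Finset.sum_congr rfl fun x _ => hf x
  have hle : ∀ p : Fin M, ∑ a, f p a ≤
      w * (if (p : ℕ) < m then Real.exp ((U.card / w) * (Real.exp s - 1)) else 1) := by
    intro p
    by_cases hp : (p : ℕ) < m
    · have h1 : ∑ a, f p a = w * ((U.card / w) * (Real.exp s - 1) + 1) := by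
        simp only [f, hp, true_and]
        rw [Finset.sum_ite]
        have h2 : (Finset.univ.filter fun a => a ∈ U) = U := by ext; simp
        have h3 : ((Finset.univ.filter fun a => a ∉ U).card : ℝ) = w - U.card := by
          have := Finset.card_filter_add_card_filter_not (s := (Finset.univ : Finset W))
            (fun a => a ∈ U)
          rw [h2, Finset.card_univ] at this
          rw [hw, ← this]
          push_cast
          ring
        rw [h2, Finset.sum_const, Finset.sum_const, nsmul_eq_mul, nsmul_eq_mul, h3]
        field_simp
        ring
      rw [h1, if_pos hp]
      gcongr
      exact Real.add_one_le_exp _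
    · simp [f, hp, hw]
  have hprod : ∏ p, ∑ a, f p a ≤
      w ^ M * Real.exp (m * ((U.card / w) * (Real.exp s - 1))) := by
    refine (Finset.prod_le_prod (fun p _ => ?_) fun p _ => hle p).trans ?_
    · refine Finset.sum_nonneg fun a _ => ?_
      simp only [f]
      split_ifs <;> positivity
    · rw [Finset.prod_mul_distrib, Finset.prod_const, Finset.prod_ite, Finset.prod_const,
        Finset.prod_const_one, mul_one, Real.exp_nat_mul, Finset.card_univ, Fintype.card_fin]
      have : (Finset.univ.filter fun p : Fin M => (p : ℕ) < m).card = m := by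
        rw [Fin.card_filter_val_lt, min_eq_right hm]
      rw [this]
  rw [Real.exp_sub, ← mul_div_assoc, le_div_iff₀ (Real.exp_pos _)]
  refine le_trans ?_ (hsum.le.trans hprod)
  rw [← nsmul_eq_mul]
  refine (Finset.card_nsmul_le_sum _ (fun x => Real.exp (s * hits m U x)) _ fun x hx => ?_).trans
    (Finset.sum_le_sum_of_subset_of_nonneg (Finset.filter_subset _ _) fun _ _ _ => by positivity)
  exact Real.exp_le_exp.2 (Finset.mem_filter.1 hx).2

/-! ### Vertices from random bits -/

theorem bitsValue_ofFn {b : ℕ} (w : Fin b → Bool) : bitsValue (List.ofFn w) = Nat.ofBits w := by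
  induction b with
  | zero => simp [bitsValue]
  | succ b ih =>
    rw [List.ofFn_succ, Nat.ofBits_succ, ← ih]
    simp [bitsValue]
    rfl

/-- The vertex that a group of random bits stands for. -/
def vertexOf (n : ℕ) [NeZero n] (w : Fin (Nat.size n) → Bool) : Fin n :=
  ⟨bitsValue (List.ofFn w) % n, Nat.mod_lt _ (NeZero.pos n)⟩

theorem ofBits_injective {b : ℕ} : Function.Injective (Nat.ofBits : (Fin b → Bool) → ℕ) := by
  intro f g h
  funext i
  rw [← Nat.testBit_ofBits_lt f i i.2, ← Nat.testBit_ofBits_lt g i i.2, h]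

theorem exists_ofBits_eq {b a : ℕ} (ha : a < 2 ^ b) : ∃ w : Fin b → Bool, Nat.ofBits w = a := by
  let φ : (Fin b → Bool) → Fin (2 ^ b) := fun w => ⟨Nat.ofBits w, Nat.ofBits_lt_two_pow w⟩
  have hφ : Function.Injective φ := fun f g h => ofBits_injective (congrArg Fin.val h)
  have hb : Function.Bijective φ :=
    (Fintype.bijective_iff_injective_and_card φ).2 ⟨hφ, by simp⟩
  obtain ⟨w, hw⟩ := hb.2 ⟨a, ha⟩
  exact ⟨w, congrArg Fin.val hw⟩

theorem two_pow_size_le {n : ℕ} (hn : 0 < n) : 2 ^ Nat.size n ≤ 2 * n := by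
  have h1 : 0 < Nat.size n := Nat.size_pos.2 hn
  have h2 : 2 ^ (Nat.size n - 1) ≤ n := Nat.lt_size.1 (by omega)
  calc 2 ^ Nat.size n = 2 * 2 ^ (Nat.size n - 1) := by
        rw [← pow_succ', Nat.sub_add_cancel h1]
    _ ≤ 2 * n := Nat.mul_le_mul_left _ h2

/-- The groups of bits that stand for a vertex in `A`. -/
def bitsIn {n : ℕ} [NeZero n] (A : Finset (Fin n)) : Finset (Fin (Nat.size n) → Bool) :=
  Finset.univ.filter fun w => vertexOf n w ∈ A

theorem card_le_card_bitsIn {n : ℕ} [NeZero n] (A : Finset (Fin n)) :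
    A.card ≤ (bitsIn A).card := by
  refine Finset.card_le_card_of_surjOn (vertexOf n) fun a ha => ?_
  obtain ⟨w, hw⟩ := exists_ofBits_eq (b := Nat.size n) (a := a)
    (a.2.trans (Nat.lt_size_self n))
  have : vertexOf n w = a := by
    ext
    simp [vertexOf, bitsValue_ofFn, hw, Nat.mod_eq_of_lt a.2]
  exact ⟨w, by simpa [bitsIn, this] using ha, this⟩

theorem card_bitsIn_le {n : ℕ} [NeZero n] (A : Finset (Fin n)) :
    (bitsIn A).card ≤ 2 * A.card := by
  refine Finset.card_le_mul_card_image_of_maps_to (f := vertexOf n)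
    (fun w hw => (Finset.mem_filter.1 hw).2) 2 fun a _ => ?_
  calc ((bitsIn A).filter fun w => vertexOf n w = a).card
      ≤ ({(a : ℕ), (a : ℕ) + n} : Finset ℕ).card := by
        refine Finset.card_le_card_of_injOn Nat.ofBits (fun w hw => ?_)
          (ofBits_injective.injOn)
        have hw' : Nat.ofBits w % n = a := by
          have := congrArg Fin.val (Finset.mem_filter.1 hw).2
          simpa [vertexOf, bitsValue_ofFn] using this
        have h1 : Nat.ofBits w < 2 * n :=
          (Nat.ofBits_lt_two_pow w).trans_le (two_pow_size_le (NeZero.pos n))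
        have h2 := Nat.mod_add_div (Nat.ofBits w) n
        have h3 : Nat.ofBits w / n < 2 := Nat.div_lt_of_lt_mul (by omega)
        simp only [Finset.coe_insert, Finset.coe_singleton, Set.mem_insert_iff,
          Set.mem_singleton_iff]
        rw [hw'] at h2
        interval_cases Nat.ofBits w / n <;> omega
    _ ≤ 2 := Finset.card_le_two

/-! ### The samples as functions of the random bits of machine `0` -/

/-- The random bits of machine `0`, cut into groups of `Nat.size n` bits. -/
def blocks {K D T n : ℕ} [NeZero n] (ω : (algorithm K D T).Coins n) :
    Fin (n * blockLen K n) → Fin (Nat.size n) → Bool :=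
  fun p i => ω 0 (finProdFinEquiv (p, i))

theorem sample_eq_vertexOf {K D T n : ℕ} [NeZero n] (ω : (algorithm K D T).Coins n)
    (p : Fin (n * blockLen K n)) :
    sample n (List.ofFn (ω 0)) p = vertexOf n (blocks ω p) := by
  have hp : (p : ℕ) * Nat.size n + Nat.size n ≤ n * blockLen K n * Nat.size n := by
    rw [← Nat.succ_mul]
    exact Nat.mul_le_mul_right _ p.2
  have : ((List.ofFn (ω 0)).drop (p * Nat.size n)).take (Nat.size n) = List.ofFn (blocks ω p) := by
    refine List.ext_getElem ?_ fun i h1 h2 => ?_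
    · have hlen : (List.ofFn (ω 0)).length = n * blockLen K n * Nat.size n := List.length_ofFn
      rw [List.length_take, List.length_drop, hlen, List.length_ofFn]
      omega
    · simp only [List.getElem_take, List.getElem_drop, List.getElem_ofFn, blocks]
      congr 1
      ext
      simp [finProdFinEquiv, add_comm, mul_comm]
  simp [sample, vertexOf, this]

/-- The groups of bits of machine `0` are independent and uniform. -/
theorem prob_blocks {K D T n : ℕ} [NeZero n]
    (P : (Fin (n * blockLen K n) → Fin (Nat.size n) → Bool) → Prop) [DecidablePred P] :
    (algorithm K D T).prob n (fun ω => P (blocks ω)) =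
      ((Finset.univ.filter P).card : ℝ) /
        (Fintype.card (Fin (Nat.size n) → Bool) : ℝ) ^ (n * blockLen K n) := by
  classical
  let e₁ : (Fin (n * blockLen K n * Nat.size n) → Bool) ≃
      (Fin (n * blockLen K n) → Fin (Nat.size n) → Bool) :=
    (Equiv.arrowCongr finProdFinEquiv.symm (Equiv.refl Bool)).trans (Equiv.curry _ _ _)
  let e : (algorithm K D T).Coins n ≃
      (Fin (n * blockLen K n) → Fin (Nat.size n) → Bool) ×
        ({j : Fin n // j ≠ 0} → Fin (n * blockLen K n * Nat.size n) → Bool) :=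
    (Equiv.piSplitAt 0 fun _ => Fin (n * blockLen K n * Nat.size n) → Bool).trans
      (Equiv.prodCongr e₁ (Equiv.refl _))
  have he : ∀ ω, (e ω).1 = blocks ω := fun ω => rfl
  have hset : {ω : (algorithm K D T).Coins n | P (blocks ω)}.ncard =
      (Finset.univ.filter P).card *
        Fintype.card ({j : Fin n // j ≠ 0} → Fin (n * blockLen K n * Nat.size n) → Bool) := by
    rw [← Finset.card_univ, ← Finset.card_product, ← Set.ncard_coe_finset]
    refine Set.ncard_congr (fun ω _ => e ω) (fun ω hω => ?_) (fun _ _ _ _ h => e.injective h)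
      fun y hy => ⟨e.symm y, ?_, e.apply_symm_apply y⟩
    · simpa [he] using hω
    · have : P y.1 := by simpa using hy
      simpa [← he] using this
  have hcard : Nat.card ((algorithm K D T).Coins n) =
      Fintype.card (Fin (Nat.size n) → Bool) ^ (n * blockLen K n) *
        Fintype.card ({j : Fin n // j ≠ 0} → Fin (n * blockLen K n * Nat.size n) → Bool) := by
    rw [Nat.card_congr e, Nat.card_prod, Nat.card_eq_fintype_card, Nat.card_eq_fintype_card,
      Fintype.card_fun, Fintype.card_fin]
  rw [Algorithm.prob, hset, hcard]
  push_cast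
  rw [mul_div_mul_right]
  simp

/-- The number of the first `m` samples that lie in `A`. -/
def samplesIn {K D T n : ℕ} [NeZero n] (m : ℕ) (A : Finset (Fin n))
    (ω : (algorithm K D T).Coins n) : ℕ :=
  hits m (bitsIn A) (blocks ω)

theorem prob_le_mul_samplesIn {K D T n : ℕ} [NeZero n] {m : ℕ} (hm : m ≤ n * blockLen K n)
    (A : Finset (Fin n)) (s c : ℝ) :
    (algorithm K D T).prob n (fun ω => c ≤ s * samplesIn m A ω) ≤
      Real.exp (m * (((bitsIn A).card / 2 ^ Nat.size n : ℝ) * (Real.exp s - 1)) - c) := by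
  classical
  rw [show (fun ω : (algorithm K D T).Coins n => c ≤ s * samplesIn m A ω) =
    fun ω => (fun x => c ≤ s * hits m (bitsIn A) x) (blocks ω) from rfl,
    prob_blocks (fun x => c ≤ s * hits m (bitsIn A) x), div_le_iff₀ (by positivity)]
  refine (card_le_mul_hits hm (bitsIn A) s c).trans ?_
  rw [mul_comm]
  simp

/-- A set that contains at least a `1 / q` fraction of the vertices rarely gets few samples. -/
theorem prob_samplesIn_le {K D T n : ℕ} [NeZero n] {m q : ℕ} (hq : 0 < q)
    (hm : m ≤ n * blockLen K n) {A : Finset (Fin n)} (hA : n ≤ q * A.card) :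
    (algorithm K D T).prob n (fun ω => 8 * q * samplesIn m A ω ≤ m) ≤
      Real.exp (-(m / (8 * q))) := by
  have hq' : (0 : ℝ) < q := by exact_mod_cast hq
  have hn : (0 : ℝ) < n := by exact_mod_cast NeZero.pos n
  have h := prob_le_mul_samplesIn (D := D) (T := T) hm A (-1) (-(m / (8 * q)))
  have hset : (fun ω : (algorithm K D T).Coins n => 8 * q * samplesIn m A ω ≤ m) =
      fun ω => -(m / (8 * q) : ℝ) ≤ -1 * (samplesIn m A ω : ℝ) := by
    funext ω
    rw [eq_iff_iff, neg_one_mul, neg_le_neg_iff, le_div_iff₀ (by positivity)]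
    rw [← Nat.cast_le (α := ℝ)]
    push_cast
    rw [mul_comm]
  rw [hset]
  refine h.trans (Real.exp_le_exp.2 ?_)
  have h1 : (1 : ℝ) / (2 * q) ≤ (bitsIn A).card / 2 ^ Nat.size n := by
    rw [div_le_div_iff₀ (by positivity) (by positivity)]
    have h2 : n ≤ q * (bitsIn A).card := hA.trans (Nat.mul_le_mul_left _ (card_le_card_bitsIn A))
    have h3 := two_pow_size_le (NeZero.pos n)
    have h4 : 1 * 2 ^ Nat.size n ≤ (bitsIn A).card * (2 * q) := by linarith
    exact_mod_cast h4
  have h2 : Real.exp (-1) - 1 ≤ -(1 / 2) := by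
    have : (2 : ℝ) ≤ Real.exp 1 := by linarith [Real.add_one_le_exp (1 : ℝ)]
    rw [Real.exp_neg]
    have : (Real.exp 1)⁻¹ ≤ (2 : ℝ)⁻¹ := inv_anti₀ (by norm_num) this
    linarith
  have h3 : ((bitsIn A).card / 2 ^ Nat.size n : ℝ) * (Real.exp (-1) - 1) ≤
      1 / (2 * q) * (-(1 / 2)) := by
    have : (0 : ℝ) < 1 / (2 * q) := by positivity
    nlinarith
  have h4 : (m : ℝ) * (((bitsIn A).card / 2 ^ Nat.size n : ℝ) * (Real.exp (-1) - 1)) ≤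
      m * (1 / (2 * q) * (-(1 / 2))) := by gcongr
  have h5 : (m : ℝ) * (1 / (2 * q) * (-(1 / 2))) = -(m / (8 * q)) - m / (8 * q) := by
    field_simp
    ring
  linarith

/-- A set that contains at most a `1 / (64 * q)` fraction of the vertices rarely gets many
samples. -/
theorem prob_lt_samplesIn_le {K D T n : ℕ} [NeZero n] {m q : ℕ} (hq : 0 < q)
    (hm : m ≤ n * blockLen K n) {A : Finset (Fin n)} (hA : 64 * q * A.card ≤ n) :
    (algorithm K D T).prob n (fun ω => m ≤ 8 * q * samplesIn m A ω) ≤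
      Real.exp (-(m / (16 * q))) := by
  have hq' : (0 : ℝ) < q := by exact_mod_cast hq
  have hn : (0 : ℝ) < n := by exact_mod_cast NeZero.pos n
  have h := prob_le_mul_samplesIn (D := D) (T := T) hm A 1 (m / (8 * q))
  have hset : (fun ω : (algorithm K D T).Coins n => m ≤ 8 * q * samplesIn m A ω) =
      fun ω => (m / (8 * q) : ℝ) ≤ 1 * (samplesIn m A ω : ℝ) := by
    funext ω
    rw [eq_iff_iff, one_mul, div_le_iff₀ (by positivity)]
    rw [← Nat.cast_le (α := ℝ)]
    push_cast
    rw [mul_comm]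
  rw [hset]
  refine h.trans (Real.exp_le_exp.2 ?_)
  have h1 : ((bitsIn A).card / 2 ^ Nat.size n : ℝ) ≤ 1 / (32 * q) := by
    rw [div_le_div_iff₀ (by positivity) (by positivity)]
    have h2 := card_bitsIn_le A
    have h3 := (Nat.lt_size_self n).le
    have h4 : (bitsIn A).card * (32 * q) ≤ 1 * 2 ^ Nat.size n := by nlinarith
    exact_mod_cast h4
  have h2 : Real.exp 1 - 1 ≤ 2 := by linarith [Real.exp_one_lt_d9]
  have h2' : 0 ≤ Real.exp 1 - 1 := by linarith [Real.add_one_le_exp (1 : ℝ)]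
  have h3 : ((bitsIn A).card / 2 ^ Nat.size n : ℝ) * (Real.exp 1 - 1) ≤ 1 / (32 * q) * 2 := by
    gcongr
  have h4 : (m : ℝ) * (((bitsIn A).card / 2 ^ Nat.size n : ℝ) * (Real.exp 1 - 1)) ≤
      m * (1 / (32 * q) * 2) := by gcongr
  have h5 : (m : ℝ) * (1 / (32 * q) * 2) = m / (8 * q) - m / (16 * q) := by
    field_simp
    ring
  linarith

/-! ### The candidates -/

theorem mem_listsOfLength {n k : ℕ} {l : List ℕ} :
    l ∈ listsOfLength n k ↔ l.length = k ∧ ∀ u ∈ l, u < n := by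
  induction k generalizing l with
  | zero => cases l <;> simp [listsOfLength]
  | succ k ih =>
    simp only [listsOfLength, List.mem_flatMap, List.mem_map, List.mem_range, ih]
    constructor
    · rintro ⟨l, ⟨h1, h2⟩, u, hu, rfl⟩
      exact ⟨by simp [h1], by simpa [hu] using h2⟩
    · rintro ⟨h1, h2⟩
      cases l with
      | nil => simp at h1
      | cons u l =>
        simp only [List.mem_cons, forall_eq_or_imp] at h2
        exact ⟨l, ⟨by simpa using h1, h2.2⟩, u, h2.1, rfl⟩

theorem length_listsOfLength (n k : ℕ) : (listsOfLength n k).length = n ^ k := by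
  induction k with
  | zero => simp [listsOfLength]
  | succ k ih => simp [listsOfLength, List.length_flatMap, ih, pow_succ]

theorem mem_candidates {n : ℕ} {l : List ℕ} :
    l ∈ candidates n ↔ 1 ≤ l.length ∧ l.length ≤ n ∧ ∀ u ∈ l, u < n := by
  simp only [candidates, List.mem_flatMap, List.mem_range, mem_listsOfLength]
  constructor
  · rintro ⟨k, hk, h1, h2⟩
    exact ⟨by omega, by omega, h2⟩
  · rintro ⟨h1, h2, h3⟩
    exact ⟨l.length - 1, by omega, by omega, h3⟩

theorem candidates_pairwise (n : ℕ) :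
    (candidates n).Pairwise fun l l' => l.length ≤ l'.length := by
  refine List.pairwise_flatMap.2 ⟨fun k _ => ?_, ?_⟩
  · refine List.pairwise_of_forall_mem_list fun l hl l' hl' => ?_
    rw [(mem_listsOfLength.1 hl).1, (mem_listsOfLength.1 hl').1]
  · refine List.pairwise_lt_range.imp fun {i j} hij l hl l' hl' => ?_
    rw [(mem_listsOfLength.1 hl).1, (mem_listsOfLength.1 hl').1]
    omega

theorem firstAccepted_of_accepted {K T n : ℕ} {coins : List Bool} {L : List (List ℕ)} {S : List ℕ}
    (hS : S ∈ candidates n) (hacc : Accepted K T n coins L S) :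
    firstAccepted K T n coins L ∈ candidates n ∧
      Accepted K T n coins L (firstAccepted K T n coins L) ∧
      (firstAccepted K T n coins L).length ≤ S.length := by
  set test : List ℕ → Bool := fun S => decide (Accepted K T n coins L S) with htest
  have hlt : (candidates n).findIdx test < (candidates n).length :=
    List.findIdx_lt_length.2 ⟨S, hS, by simpa [htest] using hacc⟩
  have heq : firstAccepted K T n coins L = (candidates n)[(candidates n).findIdx test] := by
    simp only [firstAccepted]
    rw [List.getD_eq_getElem _ _ hlt]
  rw [heq]
  refine ⟨List.getElem_mem _, ?_, ?_⟩
  · simpa [htest] using List.findIdx_getElem (w := hlt)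
  · obtain ⟨j, hj, rfl⟩ := List.getElem_of_mem hS
    have hij : (candidates n).findIdx test ≤ j := by
      by_contra hcon
      have := List.not_of_lt_findIdx (not_le.1 hcon)
      simp [htest, hacc] at this
    rcases hij.lt_or_eq with h | h
    · exact List.pairwise_iff_getElem.1 (candidates_pairwise n) _ _ hlt hj h
    · simp [h]

theorem firstAccepted_bounds (K T n : ℕ) (coins : List Bool) (L : List (List ℕ)) :
    (firstAccepted K T n coins L).length ≤ n ∧ ∀ u ∈ firstAccepted K T n coins L, u < n := by
  rcases Nat.lt_or_ge ((candidates n).findIdx fun S => decide (Accepted K T n coins L S))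
    (candidates n).length with h | h
  · have heq : firstAccepted K T n coins L = _ := List.getD_eq_getElem (candidates n) [] h
    rw [heq]
    exact (mem_candidates.1 (List.getElem_mem h)).2
  · have heq : firstAccepted K T n coins L = [] := List.getD_eq_default _ _ h
    simp [heq]

/-! ### The neighbourhoods collected in the first round -/

section Neighborhoods

variable {n : ℕ} {G : SimpleGraph (Fin n)} (I : EdgeSplit G)

/-- The edges stored on a machine, as pairs of natural numbers. -/
def edgeList (i : Fin n) : List (ℕ × ℕ) := (I.part i).map fun e => ((e.1 : ℕ), (e.2 : ℕ))

/-- The closed neighbourhood of `v` as machine `v` knows it after the first message exchange: `v`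
itself, and then its neighbours in the order of the machines that sent them. -/
def closedNbhd (v : Fin n) : List ℕ :=
  (v : ℕ) :: (List.ofFn fun j => neighborsIn (edgeList I j) v).flatten

theorem count_neighborsIn_le (l : List (Fin n × Fin n)) (u v : Fin n) :
    (neighborsIn (l.map fun e => ((e.1 : ℕ), (e.2 : ℕ))) v).count (u : ℕ) ≤
      l.count (u, v) + l.count (v, u) := by
  induction l with
  | nil => simp [neighborsIn]
  | cons e l ih =>
    obtain ⟨a, b⟩ := e
    simp only [neighborsIn, List.map_cons, List.filterMap_cons, Fin.val_inj,
      List.count_cons, beq_iff_eq, Prod.mk.injEq] at ih ⊢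
    by_cases h1 : a = v
    · subst h1
      simp only [if_true, List.count_cons, beq_iff_eq, Fin.val_inj]
      grind
    · by_cases h2 : b = v
      · subst h2
        simp only [h1, if_true, if_false, List.count_cons, beq_iff_eq, Fin.val_inj]
        grind
      · simp only [h1, h2, if_false]
        omega

theorem mem_neighborsIn {l : List (ℕ × ℕ)} {u v : ℕ} (h : (u, v) ∈ l ∨ (v, u) ∈ l) :
    u ∈ neighborsIn l v := by
  rw [neighborsIn, List.mem_filterMap]
  rcases h with h | h
  · by_cases huv : u = v
    · exact ⟨_, h, by simp [huv]⟩
    · exact ⟨_, h, by simp [huv]⟩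
  · exact ⟨_, h, by simp⟩

theorem mem_edge_of_mem_neighborsIn {l : List (ℕ × ℕ)} {u v : ℕ} (h : u ∈ neighborsIn l v) :
    (u, v) ∈ l ∨ (v, u) ∈ l := by
  rw [neighborsIn, List.mem_filterMap] at h
  obtain ⟨⟨a, b⟩, he, h⟩ := h
  split_ifs at h <;> simp_all

theorem mem_edgeList {i : Fin n} {a b : ℕ} (h : (a, b) ∈ edgeList I i) :
    ∃ u v : Fin n, (u : ℕ) = a ∧ (v : ℕ) = b ∧ G.Adj u v := by
  simp only [edgeList, List.mem_map, Prod.mk.injEq] at h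
  obtain ⟨e, he, rfl, rfl⟩ := h
  exact ⟨e.1, e.2, rfl, rfl, I.adj_of_mem i e he⟩

theorem adj_of_mem_neighborsIn {i v : Fin n} {a : ℕ} (h : a ∈ neighborsIn (edgeList I i) v) :
    ∃ u : Fin n, (u : ℕ) = a ∧ G.Adj u v := by
  rcases mem_edge_of_mem_neighborsIn h with h | h
  · obtain ⟨u, w, hu, hw, hadj⟩ := mem_edgeList I h
    exact ⟨u, hu, Fin.ext hw ▸ hadj⟩
  · obtain ⟨w, u, hw, hu, hadj⟩ := mem_edgeList I h
    exact ⟨u, hu, (Fin.ext hw ▸ hadj).symm⟩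

theorem mem_closedNbhd {u v : Fin n} : (u : ℕ) ∈ closedNbhd I v ↔ u = v ∨ G.Adj u v := by
  simp only [closedNbhd, List.mem_cons, Fin.val_inj, List.mem_flatten, List.mem_ofFn]
  refine or_congr_right ⟨?_, fun h => ?_⟩
  · rintro ⟨_, ⟨i, rfl⟩, hu⟩
    obtain ⟨u', hu', h⟩ := adj_of_mem_neighborsIn I hu
    rwa [Fin.ext hu'] at h
  · have h1 := I.exactly_once u v h
    obtain ⟨i, -, hi⟩ : ∃ i ∈ Finset.univ,
        (I.part i).count (u, v) + (I.part i).count (v, u) ≠ 0 :=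
      Finset.exists_ne_zero_of_sum_ne_zero (by rw [h1]; exact one_ne_zero)
    refine ⟨_, ⟨i, rfl⟩, mem_neighborsIn ?_⟩
    have : (u, v) ∈ I.part i ∨ (v, u) ∈ I.part i := by
      by_contra! hcon
      rw [List.count_eq_zero_of_not_mem hcon.1, List.count_eq_zero_of_not_mem hcon.2] at hi
      exact hi rfl
    rcases this with h | h
    · exact Or.inl (List.mem_map.2 ⟨_, h, rfl⟩)
    · exact Or.inr (List.mem_map.2 ⟨_, h, rfl⟩)

theorem lt_of_mem_closedNbhd {v : Fin n} {a : ℕ} (h : a ∈ closedNbhd I v) : a < n := by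
  simp only [closedNbhd, List.mem_cons, List.mem_flatten, List.mem_ofFn] at h
  rcases h with rfl | ⟨_, ⟨i, rfl⟩, h⟩
  · exact v.2
  · obtain ⟨u, rfl, -⟩ := adj_of_mem_neighborsIn I h
    exact u.2

/-- No vertex is listed twice, because every edge is stored only once. -/
theorem nodup_closedNbhd (v : Fin n) : (closedNbhd I v).Nodup := by
  rw [closedNbhd, List.nodup_cons]
  constructor
  · intro h
    simp only [List.mem_flatten, List.mem_ofFn] at h
    obtain ⟨_, ⟨i, rfl⟩, h⟩ := h
    obtain ⟨u, hu, hadj⟩ := adj_of_mem_neighborsIn I h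
    rw [Fin.ext hu] at hadj
    exact G.irrefl hadj
  · rw [List.nodup_iff_count_le_one]
    intro a
    by_cases ha : a ∈ (List.ofFn fun j => neighborsIn (edgeList I j) v).flatten
    · obtain ⟨_, hl, h⟩ := List.mem_flatten.1 ha
      obtain ⟨i, rfl⟩ := List.mem_ofFn.1 hl
      obtain ⟨u, rfl, hadj⟩ := adj_of_mem_neighborsIn I h
      rw [List.count_flatten, List.map_ofFn, List.sum_ofFn, ← I.exactly_once u v hadj]
      exact Finset.sum_le_sum fun j _ => count_neighborsIn_le _ _ _
    · rw [List.count_eq_zero_of_not_mem ha]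
      exact zero_le_one

theorem length_closedNbhd_le (v : Fin n) : (closedNbhd I v).length ≤ n := by
  have h := ((nodup_closedNbhd I v).subperm fun a ha =>
    List.mem_range.2 (lt_of_mem_closedNbhd I ha)).length_le
  simpa using h

/-- The vertices among the first `d` entries of the list of the closed neighbourhood. -/
def truncatedNbhd (d : ℕ) (v : Fin n) : Finset (Fin n) :=
  Finset.univ.filter fun u => (u : ℕ) ∈ (closedNbhd I v).take d

theorem truncatedNbhd_complete_or_card (d : ℕ) (v : Fin n) :
    (∀ u, u = v ∨ G.Adj u v → u ∈ truncatedNbhd I d v) ∨ d ≤ (truncatedNbhd I d v).card := by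
  rcases Nat.lt_or_ge d (closedNbhd I v).length with h | h
  · right
    have h1 : ((closedNbhd I v).take d).Nodup :=
      (nodup_closedNbhd I v).sublist (List.take_sublist _ _)
    have h2 : (truncatedNbhd I d v).map Fin.valEmbedding =
        ((closedNbhd I v).take d).toFinset := by
      ext a
      simp only [truncatedNbhd, Finset.mem_map, Finset.mem_filter, Finset.mem_univ, true_and,
        Fin.valEmbedding_apply, List.mem_toFinset]
      constructor
      · rintro ⟨u, hu, rfl⟩
        exact hu
      · intro ha
        exact ⟨⟨a, lt_of_mem_closedNbhd I (List.mem_of_mem_take ha)⟩, ha, rfl⟩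
    rw [← Finset.card_map Fin.valEmbedding, h2, List.toFinset_card_of_nodup h1, List.length_take]
    omega
  · left
    intro u hu
    simp only [truncatedNbhd, Finset.mem_filter, Finset.mem_univ, true_and,
      List.take_of_length_le h]
    exact (mem_closedNbhd I).2 hu

end Neighborhoods

/-! ### The execution -/

section Execution

variable {K D T n : ℕ} {G : SimpleGraph (Fin n)} (I : EdgeSplit G)

theorem message_zero (ω : (algorithm K D T).Coins n) (i j : Fin n) :
    (algorithm K D T).message I ω 0 i j = neighborsIn (edgeList I i) j := rfl

theorem received_two (ω : (algorithm K D T).Coins n) (i : Fin n) :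
    (algorithm K D T).received I ω 2 i =
      [List.ofFn fun j => neighborsIn (edgeList I j) i,
        List.ofFn fun j => (algorithm K D T).message I ω 1 j i] := rfl

variable [NeZero n]

/-- The number of words that machine `0` requests from machine `v`. -/
def request (ω : (algorithm K D T).Coins n) (v : ℕ) : ℕ :=
  cap K D n (firstSample K n (List.ofFn (ω 0)) v)

/-- The list that machine `v` returns to machine `0`. -/
def returned (ω : (algorithm K D T).Coins n) (v : Fin n) : List ℕ :=
  (closedNbhd I v).take (request ω v)

theorem message_one (ω : (algorithm K D T).Coins n) (i j : Fin n) :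
    (algorithm K D T).message I ω 1 i j = if i = 0 then [request ω j] else [] := by
  by_cases hi : i = 0
  · subst hi
    simp [Algorithm.message, Algorithm.view, Algorithm.mkView, Algorithm.received, algorithm,
      sendFun, request]
  · have : (i : ℕ) ≠ 0 := fun h => hi (Fin.ext (by simpa using h))
    simp [Algorithm.message, Algorithm.view, Algorithm.mkView, Algorithm.received, algorithm,
      sendFun, hi]

theorem message_two (ω : (algorithm K D T).Coins n) (i j : Fin n) :
    (algorithm K D T).message I ω 2 i j = if j = 0 then returned I ω i else [] := by
  have h0 : (List.ofFn fun j => (algorithm K D T).message I ω 1 j i).getD 0 [] =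
      [request ω i] := by
    rw [List.getD_eq_getElem _ _ (by simpa using NeZero.pos n), List.getElem_ofFn, message_one]
    simp
  have : (algorithm K D T).message I ω 2 i j =
      sendFun K D (n, i, edgeList I i, List.ofFn (ω i), (algorithm K D T).received I ω 2 i) j := rfl
  rw [this, received_two]
  simp only [sendFun, List.length_cons, List.length_nil, List.getD_cons_succ, List.getD_cons_zero,
    h0]
  simp [returned, closedNbhd]

theorem report_eq (ω : (algorithm K D T).Coins n) :
    (algorithm K D T).report I ω 4 =
      firstAccepted K T n (List.ofFn (ω 0)) (List.ofFn (returned I ω)) := by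
  have : (algorithm K D T).report I ω 4 = firstAccepted K T n (List.ofFn (ω 0))
      (List.ofFn fun j => (algorithm K D T).message I ω 2 j 0) := rfl
  rw [this]
  simp only [message_two, if_true]

/-! ### Correctness for given random bits -/

theorem samplesIn_mono {ω : (algorithm K D T).Coins n} {m : ℕ} {A B : Finset (Fin n)}
    (h : ∀ p : Fin (n * blockLen K n), (p : ℕ) < m → vertexOf n (blocks ω p) ∈ A →
      vertexOf n (blocks ω p) ∈ B) : samplesIn m A ω ≤ samplesIn m B ω := by
  unfold samplesIn hits
  refine Finset.card_le_card fun p hp => ?_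
  simp only [bitsIn, Finset.mem_filter, Finset.mem_univ, true_and] at hp ⊢
  exact ⟨hp.1, h p hp.1 hp.2⟩

/-- The vertices whose returned lists are missed by `S`. -/
def missedVertices (ω : (algorithm K D T).Coins n) (S : List ℕ) : Finset (Fin n) :=
  Finset.univ.filter fun v => ¬ ∃ u ∈ S, u ∈ returned I ω v

theorem length_missedSamples (ω : (algorithm K D T).Coins n) {S : List ℕ} (hS : S.length ≤ n) :
    (missedSamples K n (List.ofFn (ω 0)) (List.ofFn (returned I ω)) S).length =
      samplesIn (S.length * blockLen K n) (missedVertices I ω S) ω := by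
  have hm : S.length * blockLen K n ≤ n * blockLen K n := Nat.mul_le_mul_right _ hS
  have hL : ∀ p : Fin (n * blockLen K n),
      (List.ofFn (returned I ω)).getD (sample n (List.ofFn (ω 0)) p) [] =
        returned I ω (vertexOf n (blocks ω p)) := by
    intro p
    rw [sample_eq_vertexOf, List.getD_eq_getElem _ _ (by simp), List.getElem_ofFn]
  have hnd : (missedSamples K n (List.ofFn (ω 0)) (List.ofFn (returned I ω)) S).Nodup :=
    List.nodup_range.filter _
  rw [← List.toFinset_card_of_nodup hnd, samplesIn, hits, ← Finset.card_map Fin.valEmbedding]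
  congr 1
  ext p
  simp only [missedSamples, List.mem_toFinset, List.mem_filter, List.mem_range, decide_eq_true_eq,
    Finset.mem_map, Finset.mem_filter, Finset.mem_univ, true_and, bitsIn, missedVertices,
    Fin.valEmbedding_apply]
  constructor
  · rintro ⟨h1, h2⟩
    refine ⟨⟨p, h1.trans_le hm⟩, ⟨h1, ?_⟩, rfl⟩
    rwa [← hL]
  · rintro ⟨p, ⟨h1, h2⟩, rfl⟩
    refine ⟨h1, ?_⟩
    rwa [hL]

/-- The set of the vertices in a list of numbers. -/
def vertexSet (n : ℕ) (S : List ℕ) : Finset (Fin n) := Finset.univ.filter fun v => (v : ℕ) ∈ S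

theorem card_vertexSet_le (n : ℕ) (S : List ℕ) : (vertexSet n S).card ≤ S.length := by
  rw [← Finset.card_map Fin.valEmbedding]
  refine (Finset.card_le_card fun a ha => ?_).trans S.toFinset_card_le
  obtain ⟨v, hv, rfl⟩ := Finset.mem_map.1 ha
  simpa [vertexSet] using hv

open Classical in
/-- The vertices that are not dominated by the vertices in a list of numbers. -/
noncomputable def undominated (G : SimpleGraph (Fin n)) (S : List ℕ) : Finset (Fin n) :=
  Finset.univ.filter fun v => v ∉ dominated G (vertexSet n S)

theorem undominated_subset_missedVertices (ω : (algorithm K D T).Coins n) (S : List ℕ) :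
    undominated G S ⊆ missedVertices I ω S := by
  intro v hv
  simp only [undominated, missedVertices, Finset.mem_filter, Finset.mem_univ, true_and] at hv ⊢
  rintro ⟨u, huS, hu⟩
  have hu' := List.mem_of_mem_take hu
  obtain ⟨u, rfl⟩ : ∃ w : Fin n, (w : ℕ) = u := ⟨⟨u, lt_of_mem_closedNbhd I hu'⟩, rfl⟩
  refine hv ?_
  rcases (mem_closedNbhd I).1 hu' with rfl | h
  · exact Or.inl (by simpa [vertexSet] using huS)
  · exact Or.inr ⟨u, by simpa [vertexSet] using huS, h⟩

/-- From a vertex that is sampled in one of the first `k` blocks, machine `0` requests a list that is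
long enough for the `k`-th block. -/
theorem le_request {ω : (algorithm K D T).Coins n} {k : ℕ} {p : Fin (n * blockLen K n)}
    (hp : (p : ℕ) < k * blockLen K n) :
    D * n / k + 1 ≤ request ω (vertexOf n (blocks ω p)) := by
  set f := firstSample K n (List.ofFn (ω 0)) (vertexOf n (blocks ω p)) with hf
  have hfp : f ≤ p := by
    by_contra hcon
    have h1 := List.not_of_lt_findIdx (not_le.1 hcon)
    simp [sample_eq_vertexOf] at h1
  have h2 : f / blockLen K n + 1 ≤ k :=
    Nat.div_lt_of_lt_mul (by rw [mul_comm]; exact hfp.trans_lt hp)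
  exact Nat.succ_le_succ (Nat.div_le_div_left h2 (Nat.succ_pos _))

theorem accepted_iff (ω : (algorithm K D T).Coins n) {S : List ℕ} (hS : S.length ≤ n) :
    Accepted K T n (List.ofFn (ω 0)) (List.ofFn (returned I ω)) S ↔
      T * samplesIn (S.length * blockLen K n) (missedVertices I ω S) ω ≤
        S.length * blockLen K n := by
  rw [Accepted, length_missedSamples I ω hS]

theorem samplesIn_undominated_of_accepted (ω : (algorithm K D T).Coins n) {S : List ℕ}
    (hS : S.length ≤ n)
    (hacc : Accepted K T n (List.ofFn (ω 0)) (List.ofFn (returned I ω)) S) :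
    T * samplesIn (S.length * blockLen K n) (undominated G S) ω ≤ S.length * blockLen K n := by
  refine le_trans ?_ ((accepted_iff I ω hS).1 hacc)
  exact Nat.mul_le_mul_left _
    (samplesIn_mono fun p _ h => undominated_subset_missedVertices I ω S h)

theorem accepted_of_samplesIn (ω : (algorithm K D T).Coins n) (L : List (Fin n))
    (hL : L.length ≤ n)
    (h : T * samplesIn (L.length * blockLen K n)
      (Finset.univ.filter fun v => ∀ u ∈ L, u ∉ truncatedNbhd I (D * n / L.length + 1) v) ω ≤
        L.length * blockLen K n) :
    Accepted K T n (List.ofFn (ω 0)) (List.ofFn (returned I ω)) (L.map Fin.val) := by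
  rw [accepted_iff I ω (by simpa using hL), List.length_map]
  refine le_trans (Nat.mul_le_mul_left _ (samplesIn_mono fun p hp hv => ?_)) h
  simp only [missedVertices, truncatedNbhd, Finset.mem_filter, Finset.mem_univ, true_and] at hv ⊢
  intro u hu hu'
  refine hv ⟨u, List.mem_map_of_mem hu, ?_⟩
  exact (List.take_sublist_take_left (le_request hp)).subset hu'

end Execution

/-! ### The probability of success -/

section Prob

variable {A : Algorithm} {n : ℕ}

theorem prob_mono {P P' : A.Coins n → Prop} (h : ∀ ω, P ω → P' ω) : A.prob n P ≤ A.prob n P' := by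
  unfold Algorithm.prob
  have : {ω | P ω}.ncard ≤ {ω | P' ω}.ncard := Set.ncard_le_ncard h (Set.toFinite _)
  gcongr

theorem prob_or_le (P P' : A.Coins n → Prop) :
    A.prob n (fun ω => P ω ∨ P' ω) ≤ A.prob n P + A.prob n P' := by
  unfold Algorithm.prob
  rw [← add_div]
  have : {ω | P ω ∨ P' ω}.ncard ≤ {ω | P ω}.ncard + {ω | P' ω}.ncard := Set.ncard_union_le _ _
  gcongr
  exact_mod_cast this

theorem prob_exists_le {ι : Type*} (s : Finset ι) (P : ι → A.Coins n → Prop) :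
    A.prob n (fun ω => ∃ i ∈ s, P i ω) ≤ ∑ i ∈ s, A.prob n (P i) := by
  classical
  induction s using Finset.induction_on with
  | empty => simp [Algorithm.prob]
  | insert i s hi ih =>
    rw [Finset.sum_insert hi]
    refine le_trans (prob_mono fun ω => ?_) ((prob_or_le (P i) _).trans (add_le_add le_rfl ih))
    simp

theorem one_sub_prob_not (P : A.Coins n → Prop) :
    1 - A.prob n (fun ω => ¬ P ω) = A.prob n P := by
  have h : {ω | P ω}.ncard + {ω | ¬ P ω}.ncard = Nat.card (A.Coins n) :=
    Set.ncard_add_ncard_compl {ω | P ω}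
  have hpos : (0 : ℝ) < Nat.card (A.Coins n) := by exact_mod_cast Nat.card_pos
  unfold Algorithm.prob
  rw [eq_comm, eq_sub_iff_add_eq, ← add_div, div_eq_one_iff_eq hpos.ne']
  exact_mod_cast h

end Prob

/-- Failure probabilities that are exponentially small in `c * Nat.size n` are polynomially small
in `n`. -/
theorem exp_neg_mul_size_le (n c : ℕ) (hn : 0 < n) :
    Real.exp (-(c * Nat.size n : ℕ)) ≤ ((n : ℝ) ^ c)⁻¹ := by
  have hn' : (0 : ℝ) < n := by exact_mod_cast hn
  rw [Real.exp_neg]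
  refine inv_anti₀ (by positivity) ?_
  have h1 : (n : ℝ) ≤ 2 ^ Nat.size n := by exact_mod_cast (Nat.lt_size_self n).le
  have h2 : (2 : ℝ) ≤ Real.exp 1 := by linarith [Real.add_one_le_exp (1 : ℝ)]
  calc (n : ℝ) ^ c ≤ (2 ^ Nat.size n) ^ c := by gcongr
    _ ≤ (Real.exp 1 ^ Nat.size n) ^ c := by gcongr
    _ = Real.exp (c * Nat.size n : ℕ) := by
      rw [← pow_mul, ← Real.exp_nat_mul, mul_comm c, mul_one]

/-- There are few candidates: with failure probability `n ^ (- 3 * k)` for every candidate of length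
`k`, the union bound still gives `1 / n`. -/
theorem sum_candidates_le {n : ℕ} (hn : 0 < n) :
    ∑ S ∈ (candidates n).toFinset, ((n : ℝ) ^ (3 * S.length))⁻¹ ≤ 1 / n := by
  have hn1 : (1 : ℝ) ≤ n := by exact_mod_cast hn
  have hsub : (candidates n).toFinset ⊆
      (Finset.range n).biUnion fun k => (listsOfLength n (k + 1)).toFinset := by
    intro S hS
    simpa [candidates] using hS
  calc ∑ S ∈ (candidates n).toFinset, ((n : ℝ) ^ (3 * S.length))⁻¹
      ≤ ∑ S ∈ (Finset.range n).biUnion fun k => (listsOfLength n (k + 1)).toFinset,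
          ((n : ℝ) ^ (3 * S.length))⁻¹ :=
        Finset.sum_le_sum_of_subset_of_nonneg hsub fun _ _ _ => by positivity
    _ ≤ ∑ k ∈ Finset.range n, ∑ S ∈ (listsOfLength n (k + 1)).toFinset,
          ((n : ℝ) ^ (3 * S.length))⁻¹ := by
        refine (Finset.sum_biUnion fun i _ j _ hij => ?_).le
        refine Finset.disjoint_left.2 fun S hi hj => hij ?_
        have h1 := (mem_listsOfLength.1 (List.mem_toFinset.1 hi)).1
        have h2 := (mem_listsOfLength.1 (List.mem_toFinset.1 hj)).1
        omega
    _ ≤ ∑ _k ∈ Finset.range n, ((n : ℝ) ^ 2)⁻¹ := by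
        refine Finset.sum_le_sum fun k _ => ?_
        have h1 : ∀ S ∈ (listsOfLength n (k + 1)).toFinset,
            ((n : ℝ) ^ (3 * S.length))⁻¹ = ((n : ℝ) ^ (3 * (k + 1)))⁻¹ := by
          intro S hS
          rw [(mem_listsOfLength.1 (List.mem_toFinset.1 hS)).1]
        rw [Finset.sum_congr rfl h1, Finset.sum_const, nsmul_eq_mul]
        have h2 : ((listsOfLength n (k + 1)).toFinset.card : ℝ) ≤ (n : ℝ) ^ (k + 1) := by
          exact_mod_cast (List.toFinset_card_le _).trans (length_listsOfLength n (k + 1)).le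
        refine (mul_le_mul_of_nonneg_right h2 (by positivity)).trans ?_
        rw [← div_eq_mul_inv, div_le_iff₀ (by positivity), ← div_eq_inv_mul,
          le_div_iff₀ (by positivity), ← pow_add]
        exact pow_le_pow_right₀ hn1 (by omega)
    _ = 1 / n := by
        rw [Finset.sum_const, Finset.card_range, nsmul_eq_mul]
        field_simp

theorem exists_isDominating_card_eq {V : Type*} [Fintype V] (G : SimpleGraph V) :
    ∃ S : Finset V, IsDominating G S ∧ S.card = dominationNumber G := by
  have hne : {k | ∃ D : Finset V, IsDominating G D ∧ D.card = k}.Nonempty :=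
    ⟨_, Finset.univ, Set.eq_univ_of_forall fun v => Or.inl (Finset.mem_univ v), rfl⟩
  exact Nat.sInf_mem hne

/-- With probability at least `1 - 2 / n`, the reported list has at most as many elements as a
smallest dominating set, and it leaves less than a `1 / q` fraction of the vertices undominated. The
constant `24 * q` makes the two tail bounds at most `n ^ (- 3 * k)` and `1 / n`; the constant
`8 * (64 * q) ^ 2` is what `exists_list_hitting` needs for a `1 / (64 * q)` fraction. -/
theorem prob_success {n : ℕ} [NeZero n] {q : ℕ} (hq : 0 < q) {G : SimpleGraph (Fin n)}
    (I : EdgeSplit G) :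
    1 - 2 / (n : ℝ) ≤ (algorithm (24 * q) (8 * (64 * q) ^ 2) (8 * q)).prob n fun ω =>
      q * (undominated G
        ((algorithm (24 * q) (8 * (64 * q) ^ 2) (8 * q)).report I ω 4)).card < n ∧
      ((algorithm (24 * q) (8 * (64 * q) ^ 2) (8 * q)).report I ω 4).length ≤
        dominationNumber G := by
  classical
  have hn : 0 < n := NeZero.pos n
  set K := 24 * q with hK
  set D := 8 * (64 * q) ^ 2 with hD
  set T := 8 * q with hT
  obtain ⟨S₀, hS₀, hcard⟩ := exists_isDominating_card_eq G
  have hk1 : 1 ≤ S₀.card := by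
    rw [Nat.one_le_iff_ne_zero, Ne, Finset.card_eq_zero]
    rintro rfl
    have : (0 : Fin n) ∈ dominated G ∅ := by rw [hS₀]; trivial
    simp [dominated] at this
  have hkn : S₀.card ≤ n := by simpa using S₀.card_le_univ
  obtain ⟨L, hLlen, hL⟩ := exists_list_hitting hn G (truncatedNbhd I (D * n / S₀.card + 1))
    (Q := 64 * q) (by omega) S₀ hS₀ fun v => by
      refine (truncatedNbhd_complete_or_card I _ v).imp_right fun h => ?_
      exact (Nat.lt_mul_div_succ (D * n) hk1).le.trans (Nat.mul_le_mul_left _ h)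
  set A := Finset.univ.filter fun v => ∀ u ∈ L, u ∉ truncatedNbhd I (D * n / S₀.card + 1) v with hA
  -- The bad events: a candidate that leaves many vertices undominated gets few of them as samples,
  -- or the good candidate `L` misses many samples.
  let Bad : (algorithm K D T).Coins n → Prop := fun ω =>
    (∃ S ∈ (candidates n).toFinset.filter (fun S => n ≤ q * (undominated G S).card),
      8 * q * samplesIn (S.length * blockLen K n) (undominated G S) ω ≤
        S.length * blockLen K n) ∨
    S₀.card * blockLen K n ≤ 8 * q * samplesIn (S₀.card * blockLen K n) A ω
  have hq' : (0 : ℝ) < q := by exact_mod_cast hq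
  have hbad : (algorithm K D T).prob n Bad ≤ 2 / n := by
    refine (prob_or_le _ _).trans ?_
    have h1 : ∑ S ∈ (candidates n).toFinset.filter (fun S => n ≤ q * (undominated G S).card),
        (algorithm K D T).prob n (fun ω =>
          8 * q * samplesIn (S.length * blockLen K n) (undominated G S) ω ≤
            S.length * blockLen K n) ≤ 1 / n := by
      refine le_trans ?_ (sum_candidates_le hn)
      refine le_trans (Finset.sum_le_sum fun S hS => ?_)
        (Finset.sum_le_sum_of_subset_of_nonneg (Finset.filter_subset _ _)
          fun _ _ _ => by positivity)
      obtain ⟨hS, hSbad⟩ := Finset.mem_filter.1 hS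
      have hSn := (mem_candidates.1 (List.mem_toFinset.1 hS)).2.1
      refine (prob_samplesIn_le hq (Nat.mul_le_mul_right _ hSn) hSbad).trans
        (le_of_eq_of_le ?_ (exp_neg_mul_size_le n (3 * S.length) hn))
      congr 2
      rw [div_eq_iff (by positivity), blockLen, hK]
      push_cast
      ring
    have h2 : (algorithm K D T).prob n (fun ω =>
        S₀.card * blockLen K n ≤ 8 * q * samplesIn (S₀.card * blockLen K n) A ω) ≤ 1 / n := by
      refine (prob_lt_samplesIn_le hq (Nat.mul_le_mul_right _ hkn) hL).trans ?_
      refine le_trans (Real.exp_le_exp.2 (neg_le_neg ?_)) ((exp_neg_mul_size_le n 1 hn).trans ?_)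
      · rw [le_div_iff₀ (by positivity), blockLen, hK]
        push_cast
        have : (1 : ℝ) ≤ S₀.card := by exact_mod_cast hk1
        have h3 : (0 : ℝ) ≤ q * Nat.size n := by positivity
        nlinarith
      · simp
    calc _ ≤ (1 : ℝ) / n + 1 / n := add_le_add ((prob_exists_le _ _).trans h1) h2
      _ = 2 / n := by ring
  calc 1 - 2 / (n : ℝ) ≤ 1 - (algorithm K D T).prob n Bad := by linarith
    _ = (algorithm K D T).prob n fun ω => ¬ Bad ω := by
      rw [← one_sub_prob_not fun ω => ¬ Bad ω]
      simp only [not_not]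
    _ ≤ _ := by
      refine prob_mono fun ω hω => ?_
      simp only [Bad, not_or, not_exists, not_and, not_le] at hω
      obtain ⟨hω1, hω2⟩ := hω
      have hcand : L.map Fin.val ∈ candidates n := by
        rw [mem_candidates, List.length_map, hLlen]
        refine ⟨hk1, hkn, fun u hu => ?_⟩
        obtain ⟨v, -, rfl⟩ := List.mem_map.1 hu
        exact v.2
      have hacc : Accepted K T n (List.ofFn (ω 0)) (List.ofFn (returned I ω)) (L.map Fin.val) := by
        refine accepted_of_samplesIn I ω L (hLlen ▸ hkn) ?_
        rw [hLlen]
        exact hω2.le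
      obtain ⟨h1, h2, h3⟩ := firstAccepted_of_accepted hcand hacc
      rw [← report_eq I ω] at h1 h2 h3
      refine ⟨?_, by rw [← hcard, ← hLlen]; simpa using h3⟩
      by_contra hcon
      have h4 := samplesIn_undominated_of_accepted I ω (mem_candidates.1 h1).2.1 h2
      exact absurd h4 (not_le.2 (hω1 _ (Finset.mem_filter.2
        ⟨List.mem_toFinset.2 h1, not_lt.1 hcon⟩)))

theorem isApproxSolution_vertexSet {n : ℕ} [NeZero n] {q : ℕ} (hq : 0 < q)
    {G : SimpleGraph (Fin n)} {lam α : ℝ} (hlam : 1 / (q : ℝ) ≤ lam) (hα : 1 ≤ α) {S : List ℕ}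
    (hS : q * (undominated G S).card < n) (hlen : S.length ≤ dominationNumber G) :
    IsApproxSolution G lam α (vertexSet n S) := by
  classical
  have hq' : (0 : ℝ) < q := by exact_mod_cast hq
  constructor
  · have h1 : (dominated G (vertexSet n S)).ncard + (undominated G S).card = n := by
      have h2 : ((undominated G S : Finset (Fin n)) : Set (Fin n)) =
          (dominated G (vertexSet n S))ᶜ := by
        ext v
        simp [undominated]
      rw [← Set.ncard_coe_finset, h2, Set.ncard_add_ncard_compl, Nat.card_fin]
    have h2 : ((dominated G (vertexSet n S)).ncard : ℝ) + (undominated G S).card = n := by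
      exact_mod_cast h1
    have h3 : (q : ℝ) * (undominated G S).card ≤ n := by exact_mod_cast hS.le
    have h4 : ((undominated G S).card : ℝ) ≤ 1 / q * n := by
      rw [one_div, ← div_eq_inv_mul, le_div_iff₀ hq']
      linarith
    have h5 : 1 / (q : ℝ) * n ≤ lam * n := by gcongr
    rw [IsDominatingWithOutliers, Nat.card_fin]
    linarith
  · have h1 : ((vertexSet n S).card : ℝ) ≤ dominationNumber G := by
      exact_mod_cast (card_vertexSet_le n S).trans hlen
    have h2 : (0 : ℝ) ≤ dominationNumber G := by positivity
    nlinarith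

/-! ### The space of the machines -/

theorem wordBits_le {m : List ℕ} {s : ℕ} (h : ∀ a ∈ m, Nat.size a ≤ s) :
    Algorithm.wordBits m ≤ m.length * (s + 1) := by
  have := List.sum_le_card_nsmul (m.map fun w => Nat.size w + 1) (s + 1) (by simpa using h)
  simpa [Algorithm.wordBits] using this

theorem messageBits_le (n : ℕ) {m : List ℕ} {s : ℕ} (h : ∀ a ∈ m, Nat.size a ≤ s) :
    Algorithm.messageBits n m ≤ Nat.size n + m.length * (s + 1) := by
  unfold Algorithm.messageBits
  split_ifs
  · exact Nat.zero_le _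
  · exact Nat.add_le_add_left (wordBits_le h) _

theorem sum_messageBits_le {n : ℕ} (f : Fin n → List ℕ) {s : ℕ}
    (h : ∀ j, ∀ a ∈ f j, Nat.size a ≤ s) :
    ∑ j, Algorithm.messageBits n (f j) ≤ n * Nat.size n + (∑ j, (f j).length) * (s + 1) := by
  refine (Finset.sum_le_sum fun j _ => messageBits_le n (h j)).trans ?_
  rw [Finset.sum_add_distrib, ← Finset.sum_mul]
  simp

section Load

variable {K D T n : ℕ} {G : SimpleGraph (Fin n)} (I : EdgeSplit G)

theorem sum_length_neighborsIn_receive_le (i : Fin n) :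
    ∑ j, (neighborsIn (edgeList I j) i).length ≤ n := by
  have h := length_closedNbhd_le I i
  rw [closedNbhd, List.length_cons, List.length_flatten, List.map_ofFn, List.sum_ofFn] at h
  exact (Nat.le_succ _).trans h

theorem sum_length_neighborsIn_send_le (l : List (ℕ × ℕ)) :
    ∑ j : Fin n, (neighborsIn l j).length ≤ 2 * l.length := by
  induction l with
  | nil => simp [neighborsIn]
  | cons e l ih =>
    have h1 : ∀ j : Fin n, (neighborsIn (e :: l) j).length ≤
        ((if e.1 = j then 1 else 0) + (if e.2 = j then 1 else 0)) + (neighborsIn l j).length := by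
      intro j
      simp only [neighborsIn, List.filterMap_cons]
      split_ifs <;> simp
    have h2 : ∀ a : ℕ, ∑ j : Fin n, (if a = j then 1 else 0) ≤ 1 := by
      intro a
      rw [Finset.sum_boole, Nat.cast_id, Finset.card_le_one]
      intro i hi j hj
      simp only [Finset.mem_filter, Finset.mem_univ, true_and] at hi hj
      exact Fin.ext (hi.symm.trans hj)
    refine (Finset.sum_le_sum fun j _ => h1 j).trans ?_
    rw [Finset.sum_add_distrib, Finset.sum_add_distrib, List.length_cons]
    have := h2 e.1
    have := h2 e.2
    omega

theorem size_le_of_lt {a : ℕ} (h : a < n) : Nat.size a ≤ Nat.size n := Nat.size_le_size h.le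

theorem size_le_of_mem_neighborsIn {i j : Fin n} :
    ∀ a ∈ neighborsIn (edgeList I i) j, Nat.size a ≤ Nat.size n := by
  intro a ha
  obtain ⟨u, rfl, -⟩ := adj_of_mem_neighborsIn I ha
  exact size_le_of_lt u.2

theorem inputBits_le (i : Fin n) :
    ((I.part i).map fun e => Algorithm.wordBits [(e.1 : ℕ), (e.2 : ℕ)]).sum ≤
      n * (2 * (Nat.size n + 1)) := by
  refine (List.sum_le_card_nsmul _ (2 * (Nat.size n + 1)) fun b hb => ?_).trans ?_
  · obtain ⟨e, -, rfl⟩ := List.mem_map.1 hb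
    exact wordBits_le (by simp [size_le_of_lt])
  · rw [List.length_map, smul_eq_mul]
    exact Nat.mul_le_mul_right _ (I.length_le i)

variable [NeZero n]

theorem size_request_le (ω : (algorithm K D T).Coins n) (v : ℕ) :
    Nat.size (request ω v) ≤ D + 1 + Nat.size n := by
  have h1 : request ω v ≤ D * n + 1 := Nat.succ_le_succ (Nat.div_le_self _ _)
  have h2 := Nat.lt_size_self n
  have hn : 0 < n := NeZero.pos n
  have h3 : D + 1 < 2 ^ (D + 1) := Nat.lt_two_pow_self
  rw [Nat.size_le, pow_add]
  calc request ω v ≤ D * n + 1 := h1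
    _ ≤ (D + 1) * n := by nlinarith
    _ < 2 ^ (D + 1) * 2 ^ Nat.size n := Nat.mul_lt_mul_of_lt_of_lt h3 h2

theorem size_le_of_mem_returned {ω : (algorithm K D T).Coins n} {i : Fin n} :
    ∀ a ∈ returned I ω i, Nat.size a ≤ Nat.size n := fun _ ha =>
  size_le_of_lt (lt_of_mem_closedNbhd I (List.mem_of_mem_take ha))

theorem sum_range_mul_div (k b : ℕ) (hb : 0 < b) (f : ℕ → ℕ) :
    ∑ p ∈ Finset.range (k * b), f (p / b) = b * ∑ j ∈ Finset.range k, f j := by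
  induction k with
  | zero => simp
  | succ k ih =>
    rw [Nat.succ_mul, Finset.sum_range_add, ih, Finset.sum_range_succ, mul_add]
    congr 1
    rw [Finset.sum_congr rfl (g := fun _ => f k), Finset.sum_const, Finset.card_range, smul_eq_mul]
    intro x hx
    rw [Nat.mul_comm k b, Nat.mul_add_div hb, Nat.div_eq_of_lt (Finset.mem_range.1 hx), add_zero]

theorem sum_div_succ_le (D n : ℕ) (hn : 0 < n) :
    ∑ k ∈ Finset.range n, D * n / (k + 1) ≤ D * n * (2 * Nat.size n) := by
  have h1 : ((∑ k ∈ Finset.range n, D * n / (k + 1) : ℕ) : ℝ) ≤ D * n * (harmonic n : ℝ) := by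
    rw [harmonic]
    push_cast
    rw [Finset.mul_sum]
    refine Finset.sum_le_sum fun k _ => ?_
    refine Nat.cast_div_le.trans ?_
    push_cast
    rw [div_eq_mul_inv]
  have h2 : Real.log n ≤ Nat.size n := by
    have h3 : (n : ℝ) ≤ 2 ^ Nat.size n := by exact_mod_cast (Nat.lt_size_self n).le
    have h4 := Real.log_le_log (by exact_mod_cast hn) h3
    rw [Real.log_pow] at h4
    have h5 : Real.log 2 ≤ 1 := by linarith [Real.log_two_lt_d9]
    have h6 : (0 : ℝ) ≤ Nat.size n := by positivity
    nlinarith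
  have h3 : (1 : ℝ) ≤ Nat.size n := by exact_mod_cast Nat.size_pos.2 hn
  have h4 : (harmonic n : ℝ) ≤ 2 * Nat.size n := by
    have := harmonic_le_one_add_log n
    linarith
  have h5 : ((∑ k ∈ Finset.range n, D * n / (k + 1) : ℕ) : ℝ) ≤
      ((D * n * (2 * Nat.size n) : ℕ) : ℝ) := by
    push_cast at h1 ⊢
    exact h1.trans (by gcongr)
  exact_mod_cast h5

/-- The requests of machine `0` are in total `O(n log² n)` words, whatever the random bits are: the
samples of the `k`-th block cost `O(n / k)` words each, and a machine that is not sampled is asked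
for a constant number of words. -/
theorem sum_request_le (hK : 0 < K) (ω : (algorithm K D T).Coins n) :
    ∑ v : Fin n, request ω v ≤
      n * (D + 1) + K * Nat.size n * (D * n * (2 * Nat.size n) + n) := by
  have hn : 0 < n := NeZero.pos n
  have hb : 0 < blockLen K n := Nat.mul_pos hK (Nat.size_pos.2 hn)
  set coins := List.ofFn (ω 0) with hcoins
  have h1 : ∀ v : Fin n, request ω v ≤ (D + 1) + ∑ p ∈ Finset.range (n * blockLen K n),
      if sample n coins p = v then cap K D n p else 0 := by
    intro v
    have hle : firstSample K n coins v ≤ n * blockLen K n := by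
      simpa [firstSample] using List.findIdx_le_length (xs := List.range (n * blockLen K n))
        (p := fun p => decide (sample n coins p = v))
    rcases hle.lt_or_eq with h | h
    · have hs : sample n coins (firstSample K n coins v) = v := by
        have := List.findIdx_getElem (xs := List.range (n * blockLen K n))
          (p := fun p => decide (sample n coins p = v)) (w := by simpa [firstSample] using h)
        simpa [firstSample] using this
      have h2 := Finset.single_le_sum (f := fun p => if sample n coins p = v then cap K D n p else 0)
        (fun _ _ => Nat.zero_le _) (Finset.mem_range.2 h)
      simp only [hs, if_true] at h2
      exact h2.trans (Nat.le_add_left _ _)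
    · have h2 : request ω v ≤ D + 1 := by
        rw [request, ← hcoins, h, cap, Nat.mul_div_cancel _ hb]
        refine Nat.succ_le_succ (Nat.div_le_of_le_mul ?_)
        nlinarith
      exact h2.trans (Nat.le_add_right _ _)
  have h2 : ∀ p, ∑ v : Fin n, (if sample n coins p = v then cap K D n p else 0) =
      cap K D n p := by
    intro p
    have hlt : sample n coins p < n := Nat.mod_lt _ hn
    rw [Finset.sum_eq_single ⟨sample n coins p, hlt⟩]
    · simp
    · intro v _ hv
      exact if_neg fun h => hv (Fin.ext h.symm)
    · simp
  refine (Finset.sum_le_sum fun v _ => h1 v).trans ?_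
  rw [Finset.sum_add_distrib, Finset.sum_comm]
  simp only [h2]
  refine Nat.add_le_add (by simp) ?_
  simp only [cap]
  rw [sum_range_mul_div n _ hb fun k => D * n / (k + 1) + 1, Finset.sum_add_distrib]
  refine Nat.mul_le_mul_left _ (Nat.add_le_add (sum_div_succ_le D n hn) (by simp))

theorem receivedBits_le (hK : 0 < K) (ω : (algorithm K D T).Coins n) (i : Fin n) :
    ∑ r ∈ Finset.range 3, ∑ j, Algorithm.messageBits n ((algorithm K D T).message I ω r j i) ≤
      (n * Nat.size n + n * (Nat.size n + 1)) +
      (n * Nat.size n + n * (D + 1 + Nat.size n + 1)) +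
      (n * Nat.size n + (n * (D + 1) + K * Nat.size n * (D * n * (2 * Nat.size n) + n)) *
        (Nat.size n + 1)) := by
  rw [Finset.sum_range_succ, Finset.sum_range_succ, Finset.sum_range_one]
  refine Nat.add_le_add (Nat.add_le_add ?_ ?_) ?_
  · simp only [message_zero]
    refine (sum_messageBits_le _ fun j => size_le_of_mem_neighborsIn I).trans ?_
    gcongr
    exact sum_length_neighborsIn_receive_le I i
  · simp only [message_one]
    refine (sum_messageBits_le _ (s := D + 1 + Nat.size n) fun j a ha => ?_).trans ?_
    · split_ifs at ha
      · rw [List.mem_singleton.1 ha]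
        exact size_request_le ω _
      · simp at ha
    · gcongr
      refine (Finset.sum_le_card_nsmul _ _ 1 fun j _ => ?_).trans (by simp)
      split_ifs <;> simp
  · simp only [message_two]
    refine (sum_messageBits_le _ (s := Nat.size n) fun j a ha => ?_).trans ?_
    · split_ifs at ha
      · exact size_le_of_mem_returned I a ha
      · simp at ha
    · gcongr
      refine le_trans (Finset.sum_le_sum fun j _ => ?_) (sum_request_le hK ω)
      split_ifs
      · exact List.length_take_le _ _
      · exact Nat.zero_le _

theorem sentBits_le (ω : (algorithm K D T).Coins n) (i : Fin n) :
    ∑ r ∈ Finset.range 3, ∑ j, Algorithm.messageBits n ((algorithm K D T).message I ω r i j) ≤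
      (n * Nat.size n + 2 * n * (Nat.size n + 1)) +
      (n * Nat.size n + n * (D + 1 + Nat.size n + 1)) +
      (n * Nat.size n + n * (Nat.size n + 1)) := by
  rw [Finset.sum_range_succ, Finset.sum_range_succ, Finset.sum_range_one]
  refine Nat.add_le_add (Nat.add_le_add ?_ ?_) ?_
  · simp only [message_zero]
    refine (sum_messageBits_le _ fun j => size_le_of_mem_neighborsIn I).trans ?_
    gcongr
    refine (sum_length_neighborsIn_send_le _).trans (Nat.mul_le_mul_left 2 ?_)
    simpa [edgeList] using I.length_le i
  · simp only [message_one]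
    refine (sum_messageBits_le _ (s := D + 1 + Nat.size n) fun j a ha => ?_).trans ?_
    · split_ifs at ha
      · rw [List.mem_singleton.1 ha]
        exact size_request_le ω _
      · simp at ha
    · gcongr
      refine (Finset.sum_le_card_nsmul _ _ 1 fun j _ => ?_).trans (by simp)
      split_ifs <;> simp
  · simp only [message_two]
    refine (sum_messageBits_le _ (s := Nat.size n) fun j a ha => ?_).trans ?_
    · split_ifs at ha
      · exact size_le_of_mem_returned I a ha
      · simp at ha
    · gcongr
      rw [Finset.sum_eq_single 0 (fun j _ hj => by simp [hj]) (by simp), if_pos rfl]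
      exact (List.length_take_le' _ _).trans (length_closedNbhd_le I i)

theorem reportBits_le (ω : (algorithm K D T).Coins n) :
    Algorithm.wordBits ((algorithm K D T).report I ω 4) ≤ n * (Nat.size n + 1) := by
  rw [report_eq]
  have h := firstAccepted_bounds K T n (List.ofFn (ω 0)) (List.ofFn (returned I ω))
  refine (wordBits_le fun a ha => size_le_of_lt (h.2 a ha)).trans ?_
  gcongr
  exact h.1

theorem load_le (hK : 0 < K) (ω : (algorithm K D T).Coins n) (i : Fin n) :
    (algorithm K D T).load I ω 4 i ≤
      (28 + 4 * D + 3 * K + 4 * K * D) * (n * Nat.size n ^ 3) := by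
  have hn : 0 < n := NeZero.pos n
  have h1 := inputBits_le I i
  have h2 := receivedBits_le I hK ω i
  have h3 := sentBits_le I ω i
  have h4 : (if i = 0 then Algorithm.wordBits ((algorithm K D T).report I ω 4) else 0) ≤
      n * (Nat.size n + 1) := by
    split_ifs
    exacts [reportBits_le I ω, Nat.zero_le _]
  have h5 : (algorithm K D T).coins n = n * (K * Nat.size n) * Nat.size n := rfl
  have hload := add_le_add (add_le_add (add_le_add (add_le_add h1 h5.le) h2) h3) h4
  refine (show (algorithm K D T).load I ω 4 i ≤ _ from hload).trans ?_
  obtain ⟨s, hs⟩ : ∃ s, Nat.size n = s + 1 :=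
    ⟨Nat.size n - 1, by have := Nat.size_pos.2 hn; omega⟩
  rw [hs]
  -- The difference of the two sides is a polynomial with nonnegative coefficients.
  refine Nat.le.intro (k := n * (s * (68 + 4 * K + 2 * K * D + 11 * D) +
    s ^ 2 * (84 + 7 * K + 4 * K * D + 12 * D) +
    s ^ 3 * (28 + 3 * K + 2 * K * D + 4 * D))) ?_
  ring

end Load

/-- Binary length is at most logarithmic. -/
theorem size_le_two_mul_one_add_log {n : ℕ} (hn : 0 < n) :
    (Nat.size n : ℝ) ≤ 2 * (1 + Real.log n) := by
  have hn' : (0 : ℝ) < n := by exact_mod_cast hn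
  have h1 : (2 : ℝ) ^ Nat.size n ≤ 2 * n := by exact_mod_cast two_pow_size_le hn
  have h2 := Real.log_le_log (by positivity) h1
  rw [Real.log_pow, Real.log_mul two_ne_zero hn'.ne'] at h2
  have h3 : (1 : ℝ) / 2 ≤ Real.log 2 := by linarith [Real.log_two_gt_d9]
  have h4 : Real.log 2 ≤ 1 := by linarith [Real.log_two_lt_d9]
  have h5 : (0 : ℝ) ≤ Nat.size n := by positivity
  nlinarith

end DominatingSketch

theorem mainTheorem5 :
    ∃ c : ℕ, ∀ ε lam : ℝ, 0 < ε → ε ≤ 1 → 0 < lam → 1 ≤ (1 + ε) * Real.log (1 / lam) →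
      ∃ (A : MapReduce.Algorithm) (C : ℝ),
        ∀ (n : ℕ) [NeZero n] (G : SimpleGraph (Fin n)) (I : MapReduce.EdgeSplit G),
          1 - 2 / (n : ℝ) ≤ A.prob n (fun ω =>
            DominatingSet.IsApproxSolution G lam ((1 + ε) * Real.log (1 / lam))
              (A.solution I ω 4)) ∧
          ∀ (ω : A.Coins n) (i : Fin n),
            (A.load I ω 4 i : ℝ) ≤ C * (n : ℝ) * (1 + Real.log (n : ℝ)) ^ c := by
  refine ⟨3, fun ε lam _ _ hlam hα => ?_⟩
  obtain ⟨m, hm⟩ := exists_nat_one_div_lt hlam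
  set q := m + 1 with hq
  have hq0 : 0 < q := Nat.succ_pos m
  set K := 24 * q
  set D := 8 * (64 * q) ^ 2
  refine ⟨DominatingSketch.algorithm K D (8 * q),
    ((28 + 4 * D + 3 * K + 4 * K * D : ℕ) : ℝ) * 8, fun n _ G I => ⟨?_, fun ω i => ?_⟩⟩
  · refine (DominatingSketch.prob_success hq0 I).trans (DominatingSketch.prob_mono fun ω hω => ?_)
    refine DominatingSketch.isApproxSolution_vertexSet hq0 ?_ hα hω.1 hω.2
    rw [hq]
    push_cast
    exact hm.le
  · have hn : 0 < n := NeZero.pos n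
    have h1 : ((DominatingSketch.algorithm K D (8 * q)).load I ω 4 i : ℝ) ≤
        ((28 + 4 * D + 3 * K + 4 * K * D : ℕ) : ℝ) * (n * (Nat.size n : ℝ) ^ 3) := by
      exact_mod_cast DominatingSketch.load_le I (by omega) ω i
    have h2 : (Nat.size n : ℝ) ^ 3 ≤ (2 * (1 + Real.log n)) ^ 3 := by
      gcongr
      exact DominatingSketch.size_le_two_mul_one_add_log hn
    calc _ ≤ ((28 + 4 * D + 3 * K + 4 * K * D : ℕ) : ℝ) * (n * (Nat.size n : ℝ) ^ 3) := h1
      _ ≤ ((28 + 4 * D + 3 * K + 4 * K * D : ℕ) : ℝ) * (n * (2 * (1 + Real.log n)) ^ 3) := by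
        gcongr
      _ = _ := by ring
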